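/- Let $X$ be an alphabet with exactly two letters. A bi-infinite word is a two-sided sequence of letters of $X$ considered up to shift; for a nonempty finite word $u$, $u^\infty=\dots uuu\dots$ denotes the bi-infinite word with period $u$. A nonempty finite word is called non-periodic if it is not of the form $v^n$ with $v$ a word and $n\ge 2$. A system of prohibitions is a finite set $V$ of finite words over $X$; it determines a bi-infinite word $W$ if $W$ is the only bi-infinite word none of whose subwords (blocks of consecutive letters) belongs to $V$. Let $F(0)=F(1)=1$ and $F(k+1)=F(k)+F(k-1)$ for $k\ge 1$. (1) If a system of prohibitions $V$ determines $W=u^\infty$, where $u$ is a nonempty non-periodic word, then $|u|\le F(|V|)$. (2) The bound is sharp for every $|V|=n\ge 2$. More precisely, let $X=\{a,b\}$, $s_0=a$, $t_0=b$, and $s_{i+1}=s_is_it_i$, $t_{i+1}=s_it_i$ for $i\ge 0$. Then for every $i\ge 1$ the words $t_i$ and $s_i$ are non-periodic, $|t_i|=F(2i)$, $|s_i|=F(2i+1)$, the word $(t_i)^\infty$ is determined by some system of exactly $2i$ prohibitions, and the word $(s_i)^\infty$ is determined by some system of exactly $2i+1$ prohibitions. -/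

import Mathlib

namespace Prohibitions

/-- The finite word `v ^ n = v v ... v`. -/
def wordPow {X : Type*} (v : List X) (n : ℕ) : List X :=
  (List.replicate n v).flatten

/-- A nonempty finite word which is not of the form `v ^ n` with `n ≥ 2`. -/
def Nonperiodic {X : Type*} (u : List X) : Prop :=
  u ≠ [] ∧ ¬ ∃ (v : List X) (n : ℕ), 2 ≤ n ∧ u = wordPow v n

/-- The finite word `v` is a subword (a block of consecutive letters) of the bi-infinite
sequence `W`. -/
def IsSubword {X : Type*} (v : List X) (W : ℤ → X) : Prop :=
  ∃ k : ℤ, ∀ (i : ℕ) (hi : i < v.length), W (k + i) = v[i]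

/-- `W` avoids every word of `V`. -/
def Satisfies {X : Type*} (W : ℤ → X) (V : Finset (List X)) : Prop :=
  ∀ v ∈ V, ¬ IsSubword v W

/-- Two bi-infinite sequences represent the same bi-infinite word: a bi-infinite word has no
distinguished origin, so sequences are identified when they differ by a shift. -/
def SameWord {X : Type*} (W W' : ℤ → X) : Prop :=
  ∃ k : ℤ, ∀ i : ℤ, W' i = W (i + k)

/-- `W` is the only bi-infinite word that satisfies the system of prohibitions `V`. -/
def Determines {X : Type*} (V : Finset (List X)) (W : ℤ → X) : Prop :=
  Satisfies W V ∧ ∀ W' : ℤ → X, Satisfies W' V → SameWord W W'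

theorem emod_toNat_lt {X : Type*} (u : List X) (hu : u ≠ []) (i : ℤ) :
    (i % (u.length : ℤ)).toNat < u.length := by
  have h : 0 < u.length := List.length_pos_iff.mpr hu
  have h1 := Int.emod_nonneg i (b := (u.length : ℤ)) (by omega)
  have h2 := Int.emod_lt_of_pos i (b := (u.length : ℤ)) (by omega)
  omega

/-- The bi-infinite word `u^∞ = ... u u u ...` with a copy of `u` starting at position `0`. -/
def periodicWord {X : Type*} (u : List X) (hu : u ≠ []) : ℤ → X :=
  fun i => u[(i % (u.length : ℤ)).toNat]'(emod_toNat_lt u hu i)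

/-- The pairs `(s i, t i)` of words with `s 0 = a`, `t 0 = b`, and
`s (i + 1) = s i ++ s i ++ t i`, `t (i + 1) = s i ++ t i`. -/
def fibPair {X : Type*} (a b : X) : ℕ → List X × List X
  | 0 => ([a], [b])
  | i + 1 =>
    ((fibPair a b i).1 ++ (fibPair a b i).1 ++ (fibPair a b i).2,
      (fibPair a b i).1 ++ (fibPair a b i).2)

/-- The word `s i`. -/
def fibS {X : Type*} (a b : X) (i : ℕ) : List X := (fibPair a b i).1

/-- The word `t i`. -/
def fibT {X : Type*} (a b : X) (i : ℕ) : List X := (fibPair a b i).2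

/-- The Fibonacci numbers normalised by `F 0 = F 1 = 1`. -/
def F (n : ℕ) : ℕ := Nat.fib (n + 1)

end Prohibitions

/-! Upper bound, by strong-type induction on the minimal period `N` of `W`. The system may be
replaced by the set of all minimal forbidden words of `W` without increasing its size
(`exists_isMinimalForbidden`). If `N ≠ 1`, let `m + 1` be the least window length that separates
positions mod `N`. Some window of length `m` then occurs at two positions, say `0` and `p`, and
cutting there splits the cycle `W` into loops of minimal periods `p` and `N - p` (`exists_split`).
Besides the prohibitions common to both loops there are at least two others, namely words that
prevent `W` from closing up either loop (`card_common`). A sequence obeying the common prohibitions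
is a walk along the two loops (`exists_walk`), so one further prohibition, a short word of one loop,
confines it to the other. Hence each loop is determined by at most `|V| - 1` prohibitions. One of
the loops even needs at most `|V| - 2`, unless a loop has period 1. If a common prohibition has a
proper subword missing from a loop, that subword replaces it and also serves as the further
prohibition. Otherwise gluing the loops along a shortest word that tells them apart gives a
contradiction (`false_of_proper_subwords`). So `N = p + (N - p) ≤ F (|V| - 2) + F (|V| - 1)`.

Sharpness: if `V` determines `W'`, the image of `W'` under `a ↦ a`, `b ↦ ab` is determined by `bb`
and the words `φ(v) a`, where `φ` is the morphism and `v ∈ V`; this costs one prohibition. Composing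
with the mirrored morphism `a ↦ ab`, `b ↦ b` gives `a ↦ aab`, `b ↦ ab`, which sends `s_i, t_i` to
`s_{i+1}, t_{i+1}` at the cost of two. -/

namespace Prohibitions

/-! ### Blocks, gluing and minimal forbidden words. -/

variable {X : Type*}

/-- The block of length `L` of `Z` starting at position `k`. -/
def block (Z : ℤ → X) (k : ℤ) (L : ℕ) : List X :=
  (List.range L).map fun i : ℕ => Z (k + i)

@[simp] theorem length_block (Z : ℤ → X) (k : ℤ) (L : ℕ) : (block Z k L).length = L := by
  simp [block]

@[simp] theorem getElem_block (Z : ℤ → X) (k : ℤ) (L i : ℕ) (h : i < (block Z k L).length) :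
    (block Z k L)[i] = Z (k + i) := by
  simp [block]

theorem block_eq_iff {Z Z' : ℤ → X} {k k' : ℤ} {L : ℕ} :
    block Z k L = block Z' k' L ↔ ∀ i : ℕ, i < L → Z (k + i) = Z' (k' + i) := by
  constructor
  · intro h i hi
    have := congrArg (fun l => l[i]?) h
    simpa [block, hi] using this
  · intro h
    apply List.ext_getElem <;> simp
    exact h

theorem isSubword_block (Z : ℤ → X) (k : ℤ) (L : ℕ) : IsSubword (block Z k L) Z :=
  ⟨k, fun i hi => by simp⟩

theorem IsSubword.exists_eq_block {v : List X} {Z : ℤ → X} (h : IsSubword v Z) :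
    ∃ k, v = block Z k v.length := by
  obtain ⟨k, hk⟩ := h
  exact ⟨k, List.ext_getElem (by simp) fun i h1 h2 => by simp [hk i h1]⟩

theorem getElem_of_eq_block {v : List X} {Z : ℤ → X} {k : ℤ} {L : ℕ} (h : v = block Z k L) {i : ℕ}
    (hi : i < v.length) : v[i] = Z (k + i) := by
  subst h
  simp

theorem infix_block_iff {v : List X} {Z : ℤ → X} {k : ℤ} {L : ℕ} :
    v <:+: block Z k L ↔ ∃ j : ℕ, j + v.length ≤ L ∧ v = block Z (k + j) v.length := by
  constructor
  · rintro ⟨s, t, h⟩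
    have hl := congrArg List.length h
    simp at hl
    refine ⟨s.length, by omega, List.ext_getElem (by simp) fun i h1 h2 => ?_⟩
    have h3 : (s ++ v ++ t)[s.length + i]'(by simp; omega) = v[i] := by
      simp [h1]
    simp only [getElem_block]
    rw [← h3]
    simp only [h, getElem_block]
    push_cast
    ring_nf
  · rintro ⟨j, hj, hv⟩
    refine ⟨block Z k j, block Z (k + j + v.length) (L - j - v.length), ?_⟩
    apply List.ext_getElem
    · simp; omega
    · intro i h1 h2
      simp only [getElem_block]
      simp only [List.getElem_append]
      simp only [length_block, List.length_append]
      split_ifs with h3 h4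
      · simp
      · simp only [not_lt] at h4
        rw [getElem_of_eq_block hv]
        congr 1; omega
      · simp only [getElem_block]; congr 1; omega

theorem block_infix_block (Z : ℤ → X) {k k' : ℤ} {L L' : ℕ} (h1 : k ≤ k')
    (h2 : k' + L' ≤ k + L) : block Z k' L' <:+: block Z k L := by
  rw [infix_block_iff]
  refine ⟨(k' - k).toNat, by simp; omega, ?_⟩
  rw [length_block]; congr 1; omega

theorem IsSubword.of_infix {v v' : List X} {Z : ℤ → X} (h : IsSubword v Z) (hv : v' <:+: v) :
    IsSubword v' Z := by
  obtain ⟨k, hk⟩ := h.exists_eq_block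
  rw [hk, infix_block_iff] at hv
  obtain ⟨j, -, hj⟩ := hv
  rw [hj]
  exact isSubword_block _ _ _

theorem isSubword_shift {v : List X} {Z : ℤ → X} (c : ℤ) :
    IsSubword v (fun i => Z (i + c)) ↔ IsSubword v Z := by
  constructor
  · rintro ⟨k, hk⟩
    exact ⟨k + c, fun i hi => by rw [← hk i hi]; congr 1; ring⟩
  · rintro ⟨k, hk⟩
    exact ⟨k - c, fun i hi => by rw [← hk i hi]; ring_nf⟩

theorem SameWord.isSubword_iff {v : List X} {Z Z' : ℤ → X} (h : SameWord Z Z') :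
    IsSubword v Z' ↔ IsSubword v Z := by
  obtain ⟨c, hc⟩ := h
  rw [← isSubword_shift (Z := Z) c, funext hc]

theorem isSubword_congr_of_agree {Z Z' : ℤ → X} {k k' : ℤ} {L : ℕ}
    (h : ∀ i : ℕ, i < L → Z (k + i) = Z' (k' + i)) : IsSubword (block Z k L) Z' := by
  rw [block_eq_iff.2 h]
  exact isSubword_block _ _ _

theorem exists_glue (Y₁ Y₂ : ℤ → X) (L : ℕ) (h : ∀ i : ℤ, 1 ≤ i → i ≤ L → Y₁ i = Y₂ i) :
    ∃ G : ℤ → X, (∀ i : ℤ, i ≤ L → G i = Y₁ i) ∧ ∀ i : ℤ, 1 ≤ i → G i = Y₂ i := by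
  refine ⟨fun i => if i ≤ L then Y₁ i else Y₂ i, fun i hi => by simp [hi], fun i hi => ?_⟩
  by_cases hL : i ≤ L
  · simp [hL, h i hi hL]
  · simp [hL]

/-- A subword of a glued sequence is a subword of one of the halves or contains the seam. -/
theorem isSubword_glue {G Y₁ Y₂ : ℤ → X} {L : ℕ} (h₁ : ∀ i : ℤ, i ≤ L → G i = Y₁ i)
    (h₂ : ∀ i : ℤ, 1 ≤ i → G i = Y₂ i) {v : List X} (hv : IsSubword v G) :
    IsSubword v Y₁ ∨ IsSubword v Y₂ ∨ block G 0 (L + 2) <:+: v := by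
  obtain ⟨k, hk⟩ := hv.exists_eq_block
  by_cases hk1 : 1 ≤ k
  · right; left
    rw [hk]
    exact isSubword_congr_of_agree (k' := k) fun i hi => h₂ _ (by omega)
  by_cases hk2 : k + v.length ≤ L + 1
  · left
    rw [hk]
    exact isSubword_congr_of_agree (k' := k) fun i hi => h₁ _ (by omega)
  · right; right
    rw [hk]
    exact block_infix_block _ (by omega) (by push_cast; omega)

/-- `V` consists of the minimal words that are not subwords of `W`, and of all of them. -/
structure IsMinimalForbidden (V : Finset (List X)) (W : ℤ → X) : Prop where
  avoid : ∀ v ∈ V, ¬ IsSubword v W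
  proper : ∀ v ∈ V, ∀ v', v' <:+: v → v' ≠ v → IsSubword v' W
  complete : ∀ q, ¬ IsSubword q W → ∃ v ∈ V, v <:+: q

theorem IsMinimalForbidden.shift {V : Finset (List X)} {W : ℤ → X} (h : IsMinimalForbidden V W)
    (c : ℤ) : IsMinimalForbidden V (fun i => W (i + c)) := by
  obtain ⟨h1, h2, h3⟩ := h
  constructor <;> simpa only [isSubword_shift]

theorem exists_minimal_infix {W : ℤ → X} {q : List X} (hq : ¬ IsSubword q W) :
    ∃ v, v <:+: q ∧ ¬ IsSubword v W ∧ ∀ v', v' <:+: v → v' ≠ v → IsSubword v' W := by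
  classical
  have hex : ∃ n, ∃ v, v <:+: q ∧ ¬ IsSubword v W ∧ v.length = n := ⟨_, q, List.infix_rfl, hq, rfl⟩
  obtain ⟨v, h1, h2, h3⟩ := Nat.find_spec hex
  refine ⟨v, h1, h2, fun v' hv' hne => ?_⟩
  by_contra hc
  have hlt : v'.length < v.length :=
    lt_of_le_of_ne hv'.length_le fun he => hne (hv'.eq_of_length he)
  exact Nat.find_min hex (h3 ▸ hlt) ⟨v', hv'.trans h1, hc, rfl⟩

theorem not_isSubword_length {W : ℤ → X} (hW : ∀ x, ∃ i, W i = x) {q : List X}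
    (hq : ¬ IsSubword q W) : 2 ≤ q.length := by
  by_contra hlt
  apply hq
  match q with
  | [] => exact ⟨0, by simp⟩
  | [x] =>
    obtain ⟨i, hi⟩ := hW x
    exact ⟨i, fun j hj => by
      have : j = 0 := by simpa using hj
      subst this; simpa using hi⟩
  | _ :: _ :: _ => simp at hlt

/-- A determining system can be reduced to the set of all minimal forbidden words. -/
theorem exists_isMinimalForbidden {V : Finset (List X)} {W : ℤ → X} (hW : ∀ x, ∃ i, W i = x)
    (hV : Determines V W) : ∃ V', V'.card ≤ V.card ∧ IsMinimalForbidden V' W := by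
  classical
  choose! f hf using fun v (hv : v ∈ V) => exists_minimal_infix (hV.1 v hv)
  refine ⟨V.image f, Finset.card_image_le, ?_, ?_, ?_⟩
  · simp only [Finset.mem_image]
    rintro _ ⟨v, hv, rfl⟩
    exact (hf v hv).2.1
  · simp only [Finset.mem_image]
    rintro _ ⟨v, hv, rfl⟩
    exact (hf v hv).2.2
  · intro q hq
    obtain ⟨v, hvq, hvW, hv⟩ := exists_minimal_infix hq
    refine ⟨v, ?_, hvq⟩
    have hlen := not_isSubword_length hW hvW
    obtain ⟨L, hL⟩ : ∃ L, v.length = L + 2 := ⟨v.length - 2, by omega⟩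
    obtain ⟨k₁, hk₁⟩ := (hv v.dropLast (List.dropLast_prefix v).isInfix fun h => by
      have := congrArg List.length h; simp at this; omega)
    obtain ⟨k₂, hk₂⟩ := (hv v.tail (List.tail_suffix v).isInfix fun h => by
      have := congrArg List.length h; simp at this; omega)
    simp only [List.length_dropLast, hL, List.getElem_dropLast, List.length_tail,
      List.getElem_tail] at hk₁ hk₂
    -- The occurrences of `v.dropLast` and `v.tail` in `W` share the `L` inner letters of `v`.
    -- Gluing along them gives a sequence that contains `v`, so it is not `W` and violates `V`.
    obtain ⟨G, hG₁, hG₂⟩ := exists_glue (fun i => W (i + k₁)) (fun i => W (i + (k₂ - 1))) L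
      (fun i h1 h2 => by
        obtain ⟨j, rfl⟩ : ∃ j : ℕ, i = j + 1 := ⟨(i - 1).toNat, by omega⟩
        have e1 := hk₁ (j + 1) (by omega)
        have e2 := hk₂ j (by omega)
        push_cast at e1
        rw [add_comm _ k₁, e1, ← e2]
        congr 1; ring)
    have hGv : block G 0 (L + 2) = v := by
      apply List.ext_getElem
      · simp [hL]
      · intro i h1 h2
        simp at h1 ⊢
        rcases Nat.lt_or_ge i (L + 1) with h | h
        · rw [hG₁ _ (by omega), add_comm, hk₁ i (by omega)]
        · rw [hG₂ _ (by omega)]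
          have := hk₂ (i - 1) (by omega)
          have hi : i - 1 + 1 = i := by omega
          simp only [hi] at this
          rw [← this]
          congr 1; push_cast [show 1 ≤ i by omega]; ring
    have hnot : ¬ SameWord W G := fun h => hvW (by
      rw [← h.isSubword_iff, ← hGv]; exact isSubword_block _ _ _)
    have : ¬ Satisfies G V := fun h => hnot (hV.2 G h)
    simp only [Satisfies, not_forall, not_not] at this
    obtain ⟨v₀, hv₀, hvG⟩ := this
    have hfv := hf v₀ hv₀
    rcases isSubword_glue hG₁ hG₂ (hvG.of_infix hfv.1) with h | h | h
    · exact absurd ((isSubword_shift _).1 h) hfv.2.1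
    · exact absurd ((isSubword_shift _).1 h) hfv.2.1
    -- The reduced prohibition can only occur across the seam, so it contains `v`; its minimality
    -- makes the two equal.
    · rw [hGv] at h
      by_cases he : v = f v₀
      · rw [he]; exact Finset.mem_image_of_mem _ hv₀
      · exact absurd (hfv.2.2 _ h he) hvW

end Prohibitions

/-! ### Cutting a periodic sequence into two loops. -/

namespace Prohibitions

variable {X : Type*}

/-- The sequence of period `p` which agrees with `W` on `[0, p)`. -/
def loop (W : ℤ → X) (p : ℤ) : ℤ → X := fun i => W (i % p)

/-- The windows of length `m + 1` of the `N`-periodic sequence `W` are pairwise distinct, while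
the windows of length `m` at positions `0` and `p` coincide. -/
structure Split (W : ℤ → X) (N p : ℤ) (m : ℕ) : Prop where
  pos : 0 < p
  lt : p < N
  periodic : ∀ i, W (i + N) = W i
  inj : ∀ i j : ℤ, (∀ r : ℕ, r ≤ m → W (i + r) = W (j + r)) → N ∣ i - j
  ret : ∀ r : ℕ, r < m → W (p + r) = W r

theorem apply_add_mul {Y : ℤ → X} {N : ℤ} (h : ∀ i, Y (i + N) = Y i) (i k : ℤ) :
    Y (i + N * k) = Y i := by
  induction k using Int.induction_on with
  | zero => simp
  | succ n ih => rw [← ih, mul_add, mul_one, ← add_assoc, h]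
  | pred n ih => rw [← ih, ← h (i + N * (-(n : ℤ) - 1))]; congr 1; ring

theorem apply_eq_of_dvd {Y : ℤ → X} {N : ℤ} (h : ∀ i, Y (i + N) = Y i) {i j : ℤ}
    (hd : N ∣ i - j) : Y i = Y j := by
  obtain ⟨k, hk⟩ := hd
  rw [← apply_add_mul h j k]
  congr 1; linarith

theorem loop_periodic (W : ℤ → X) (p i : ℤ) : loop W p (i + p) = loop W p i := by
  simp [loop]

theorem eq_of_dvd_sub {N a b : ℤ} (ha : 0 ≤ a) (ha' : a < N) (hb : 0 ≤ b) (hb' : b < N)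
    (h : N ∣ a - b) : a = b := by
  have h1 := (Int.emod_eq_emod_iff_emod_sub_eq_zero (m := a) (n := N) (k := b)).2
    (Int.emod_eq_zero_of_dvd h)
  rwa [Int.emod_eq_of_lt ha ha', Int.emod_eq_of_lt hb hb'] at h1

namespace Split

variable {W : ℤ → X} {N p : ℤ} {m : ℕ}

/-- Moving the origin to `p` exchanges the two arcs, so every fact about the first loop yields one
about the second. -/
theorem symm (h : Split W N p m) : Split (fun i => W (i + p)) N (N - p) m where
  pos := by have := h.lt; omega
  lt := by have := h.pos; omega
  periodic i := by rw [← h.periodic (i + p)]; ring_nf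
  inj i j hij := by
    have := h.inj (i + p) (j + p) fun r hr => by
      have := hij r hr
      ring_nf at this ⊢; exact this
    simpa using this
  ret r hr := by
    have h1 := h.ret r hr
    have h2 := h.periodic r
    rw [add_comm (r : ℤ) p, h1, ← h2]; ring_nf

/-- By `ret`, `W` itself has period `p` on `[0, p + m)`. This is why windows of length `m + 1` that
start in the first arc cannot tell the loop from `W`. -/
theorem loop_eq (h : Split W N p m) : ∀ i : ℕ, (i : ℤ) < p + m → loop W p i = W i := by
  intro i
  induction i using Nat.strong_induction_on with
  | _ i ih =>
    intro hi
    have hp := h.pos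
    by_cases hip : (i : ℤ) < p
    · rw [loop, Int.emod_eq_of_lt (by omega) hip]
    · obtain ⟨r, hr⟩ : ∃ r : ℕ, (i : ℤ) = p + r := ⟨(i - p).toNat, by omega⟩
      have h1 := ih r (by omega) (by omega)
      rw [hr, h.ret r (by omega), ← h1, add_comm, loop_periodic]

theorem loop_window (h : Split W N p m) (k : ℤ) {r : ℕ} (hr : k % p + r < p + m) :
    loop W p (k + r) = W (k % p + r) := by
  have h1 := Int.emod_nonneg k h.pos.ne'
  obtain ⟨j, hj⟩ : ∃ j : ℕ, (j : ℤ) = k % p + r := ⟨(k % p + r).toNat, by omega⟩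
  rw [← hj, ← h.loop_eq j (by omega), hj]
  simp [loop]

theorem loop_window_le (h : Split W N p m) (k : ℤ) {r : ℕ} (hr : r ≤ m) :
    loop W p (k + r) = W (k % p + r) :=
  h.loop_window k (by have := Int.emod_lt_of_pos k h.pos; omega)

theorem loop_inj (h : Split W N p m) {i j : ℤ}
    (hij : ∀ r : ℕ, r ≤ m → loop W p (i + r) = loop W p (j + r)) : p ∣ i - j := by
  have hi := Int.emod_nonneg i h.pos.ne'
  have hi' := Int.emod_lt_of_pos i h.pos
  have hj := Int.emod_nonneg j h.pos.ne'
  have hj' := Int.emod_lt_of_pos j h.pos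
  have hlt := h.lt
  have h1 := h.inj (i % p) (j % p) fun r hr => by
    rw [← h.loop_window_le i hr, ← h.loop_window_le j hr, hij r hr]
  have h2 := eq_of_dvd_sub hi (by omega) hj (by omega) h1
  exact Int.dvd_of_emod_eq_zero (Int.emod_eq_emod_iff_emod_sub_eq_zero.1 h2)

theorem isSubword_of_loop (h : Split W N p m) {v : List X} (hv : IsSubword v (loop W p))
    (hl : v.length ≤ m + 1) : IsSubword v W := by
  obtain ⟨k, hk⟩ := hv
  exact ⟨k % p, fun i hi => by rw [← hk i hi, h.loop_window_le k (by omega)]⟩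

theorem block_isSubword_loop (h : Split W N p m) {i : ℤ} (h0 : 0 ≤ i) (hi : i < p) :
    IsSubword (block W i (m + 1)) (loop W p) :=
  isSubword_congr_of_agree (k' := i) fun r hr => by
    rw [h.loop_window_le i (by omega), Int.emod_eq_of_lt h0 hi]

theorem block_not_isSubword_loop (h : Split W N p m) {i : ℤ} (h0 : p ≤ i) (hi : i < N) :
    ¬ IsSubword (block W i (m + 1)) (loop W p) := by
  rintro ⟨k, hk⟩
  have h1 := Int.emod_nonneg k h.pos.ne'
  have h2 := Int.emod_lt_of_pos k h.pos
  have hp := h.pos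
  have h3 := h.inj (k % p) i fun r hr => by
    have := hk r (by simp; omega)
    rw [← h.loop_window_le k hr, this]
    simp
  have := eq_of_dvd_sub h1 (by omega) (by omega) hi h3
  omega

theorem block_eq_of_dvd (h : Split W N p m) {i j : ℤ} (hd : N ∣ i - j) (L : ℕ) :
    block W i L = block W j L :=
  block_eq_iff.2 fun r _ => apply_eq_of_dvd h.periodic (by ring_nf; simpa using hd)

/-- The sequence of the other loop. -/
def other (W : ℤ → X) (N p : ℤ) : ℤ → X := loop (fun i => W (i + p)) (N - p)

theorem other_other (h : Split W N p m) :
    other (fun i => W (i + p)) N (N - p) = loop W p := by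
  have : (fun i => W (i + (N - p) + p)) = W := by
    funext i; rw [← h.periodic i]; ring_nf
  rw [other, this]; ring_nf

theorem isSubword_of_other (h : Split W N p m) {v : List X} (hv : IsSubword v (other W N p))
    (hl : v.length ≤ m + 1) : IsSubword v W :=
  (isSubword_shift p).1 (h.symm.isSubword_of_loop hv hl)

theorem block_isSubword_other (h : Split W N p m) {i : ℤ} (h0 : p ≤ i) (hi : i < N) :
    IsSubword (block W i (m + 1)) (other W N p) := by
  have := h.symm.block_isSubword_loop (i := i - p) (by omega) (by omega)
  simpa [block, add_right_comm, other] using this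

theorem block_not_isSubword_other (h : Split W N p m) {i : ℤ} (h0 : 0 ≤ i) (hi : i < p) :
    ¬ IsSubword (block W i (m + 1)) (other W N p) := by
  have := h.symm.block_not_isSubword_loop (i := i - p + N) (by omega) (by omega)
  rwa [show block _ (i - p + N) (m + 1) = block W i (m + 1) from ?_] at this
  refine block_eq_iff.2 fun r hr => ?_
  rw [← h.periodic (i + r)]; ring_nf

/-- A word of length at most `m + 1` that occurs in `W` outside the first loop lies in a window of
the second one. -/
theorem exists_window (h : Split W N p m) {v : List X} (hl : v.length ≤ m + 1)
    (hv : IsSubword v W) (hn : ¬ IsSubword v (loop W p)) :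
    ∃ i, p ≤ i ∧ i < N ∧ v <:+: block W i (m + 1) := by
  obtain ⟨k, hk⟩ := hv.exists_eq_block
  have hN : 0 < N := h.pos.trans h.lt
  have hvi : v <:+: block W (k % N) (m + 1) := by
    rw [infix_block_iff]
    refine ⟨0, by omega, ?_⟩
    conv_lhs => rw [hk]
    refine h.block_eq_of_dvd ?_ _
    simpa using Int.dvd_self_sub_emod
  refine ⟨k % N, ?_, Int.emod_lt_of_pos k hN, hvi⟩
  by_contra hlt
  exact hn ((h.block_isSubword_loop (Int.emod_nonneg k hN.ne') (by omega)).of_infix hvi)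

end Split

open Classical in
/-- The prohibitions of `V` which hold in both loops. -/
noncomputable def common (V : Finset (List X)) (Y₁ Y₂ : ℤ → X) : Finset (List X) :=
  V.filter fun v => ¬ IsSubword v Y₁ ∧ ¬ IsSubword v Y₂

theorem mem_common {V : Finset (List X)} {Y₁ Y₂ : ℤ → X} {v : List X} :
    v ∈ common V Y₁ Y₂ ↔ v ∈ V ∧ ¬ IsSubword v Y₁ ∧ ¬ IsSubword v Y₂ := by
  simp [common]

end Prohibitions

/-! ### Minimal forbidden words as steps between windows. -/

namespace Prohibitions

variable {X : Type*} {W : ℤ → X} {N p : ℤ} {m : ℕ} {V : Finset (List X)}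

open Split (other)

/-- In a longer word, `v.dropLast` and `v.tail` overlap in at least `m + 1` letters. That overlap
fixes the position mod `N`, so the two occurrences align and `v` would occur in `W`. -/
theorem IsMinimalForbidden.length_le (hV : IsMinimalForbidden V W) (h : Split W N p m)
    {v : List X} (hv : v ∈ V) : v.length ≤ m + 2 := by
  by_contra! hlt
  apply hV.avoid v hv
  obtain ⟨k₁, hk₁⟩ := hV.proper v hv v.dropLast (List.dropLast_prefix v).isInfix fun h => by
      have := congrArg List.length h; simp at this; omega
  obtain ⟨k₂, hk₂⟩ := hV.proper v hv v.tail (List.tail_suffix v).isInfix fun h => by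
      have := congrArg List.length h; simp at this; omega
  simp only [List.length_dropLast, List.getElem_dropLast, List.length_tail,
      List.getElem_tail] at hk₁ hk₂
  have hd := h.inj k₂ (k₁ + 1) fun r hr => by
    have e1 := hk₁ (r + 1) (by omega)
    have e2 := hk₂ r (by omega)
    rw [e2, ← e1]; push_cast; ring_nf
  refine ⟨k₁, fun i hi => ?_⟩
  rcases Nat.lt_or_ge i (v.length - 1) with h1 | h1
  · exact hk₁ i h1
  · have e2 := hk₂ (i - 1) (by omega)
    have hi' : i - 1 + 1 = i := by omega
    simp only [hi'] at e2
    rw [← e2]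
    apply apply_eq_of_dvd h.periodic
    rw [dvd_sub_comm]
    have : (((i - 1 : ℕ) : ℤ)) = i - 1 := by omega
    rw [this]; ring_nf at hd ⊢; exact hd

/-- A minimal forbidden word that occurs in the first loop pins down the two windows it covers. -/
theorem IsMinimalForbidden.window_of_loop (hV : IsMinimalForbidden V W) (h : Split W N p m)
    {v : List X} (hv : v ∈ V) (hs : IsSubword v (loop W p)) {Z : ℤ → X} {k : ℤ}
    (hvZ : v <:+: block Z k (m + 2)) :
    (∀ r : ℕ, r ≤ m → Z (k + r) = W (p - 1 + r)) ∧ ∀ r : ℕ, r ≤ m → Z (k + 1 + r) = W r := by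
  have hl : v.length = m + 2 := by
    have h1 := hvZ.length_le
    simp only [length_block] at h1
    by_contra hne
    exact hV.avoid v hv (h.isSubword_of_loop hs (by omega))
  have hvZ' : v = block Z k (m + 2) := hvZ.eq_of_length (by simp [hl])
  obtain ⟨κ, hκ⟩ := hs.exists_eq_block
  rw [hl, hvZ', block_eq_iff] at hκ
  have h0 := Int.emod_nonneg κ h.pos.ne'
  have h1 := Int.emod_lt_of_pos κ h.pos
  have hp := h.pos
  -- From any earlier position, `m + 2` letters stay inside `[0, p + m)`, where the loop agrees with
  -- `W`. Only the closing step of the loop is new.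
  have h2 : κ % p = p - 1 := by
    by_contra hne
    apply hV.avoid v hv
    rw [hvZ']
    refine isSubword_congr_of_agree (k' := κ % p) fun r hr => ?_
    rw [hκ r hr, h.loop_window κ (by omega)]
  refine ⟨fun r hr => ?_, fun r hr => ?_⟩
  · rw [hκ r (by omega), h.loop_window_le κ hr, h2]
  · have h3 := hκ (r + 1) (by omega)
    have h4 : (κ + 1) % p = 0 := by
      rw [Int.add_emod, h2]
      rcases eq_or_ne p 1 with rfl | hne
      · simp
      · rw [Int.emod_eq_of_lt (a := 1) (by omega) (by omega)]; simp
    push_cast at h3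
    rw [show k + 1 + (r : ℤ) = k + (r + 1) by ring, h3,
      show κ + ((r : ℤ) + 1) = κ + 1 + r by ring, h.loop_window_le _ hr, h4, zero_add]

/-- A sequence without common prohibitions walks along the two loops. -/
theorem exists_walk (h : Split W N p m) (hV : IsMinimalForbidden V W) {Z : ℤ → X}
    (hZ : Satisfies Z (common V (loop W p) (other W N p))) :
    ∃ π : ℤ → ℤ, ∀ k, (0 ≤ π k ∧ π k < N) ∧ (∀ r : ℕ, r ≤ m → Z (k + r) = W (π k + r)) ∧
      (π (k + 1) = π k + 1 ∨ (π k = N - 1 ∧ (π (k + 1) = 0 ∨ π (k + 1) = p)) ∨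
        (π k = p - 1 ∧ π (k + 1) = 0)) := by
  have hp := h.pos
  have hpN := h.lt
  have hN : 0 < N := hp.trans hpN
  have hwin : ∀ k, ∃ i, (0 ≤ i ∧ i < N) ∧ ∀ r : ℕ, r ≤ m → Z (k + r) = W (i + r) := by
    -- Words of length at most `m + 1` in either loop occur in `W`, so a prohibition this short is
    -- automatically common.
    intro k
    have hsub : IsSubword (block Z k (m + 1)) W := by
      by_contra hn
      obtain ⟨v, hv, hvi⟩ := hV.complete _ hn
      have hl := hvi.length_le
      simp only [length_block] at hl
      refine hZ v (mem_common.2 ⟨hv, fun hs => ?_, fun hs => ?_⟩)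
        ((isSubword_block _ _ _).of_infix hvi)
      · exact hV.avoid v hv (h.isSubword_of_loop hs hl)
      · exact hV.avoid v hv (h.isSubword_of_other hs hl)
    obtain ⟨i, hi⟩ := hsub
    refine ⟨i % N, ⟨Int.emod_nonneg i hN.ne', Int.emod_lt_of_pos i hN⟩, fun r hr => ?_⟩
    have := hi r (by simp; omega)
    simp only [getElem_block] at this
    rw [← this]
    apply apply_eq_of_dvd h.periodic
    ring_nf
    exact Int.dvd_self_sub_emod
  choose π hπ hπW using hwin
  refine ⟨π, fun k => ⟨hπ k, hπW k, ?_⟩⟩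
  have hstep : ∀ i j, (∀ r : ℕ, r ≤ m → Z (k + r) = W (i + r)) →
      (∀ r : ℕ, r ≤ m → Z (k + 1 + r) = W (j + r)) →
      N ∣ π k - i ∧ N ∣ π (k + 1) - j := fun i j hi hj =>
    ⟨h.inj _ _ fun r hr => by rw [← hi r hr, hπW k r hr],
      h.inj _ _ fun r hr => by rw [← hj r hr, hπW (k + 1) r hr]⟩
  have hk := hπ k
  have hk1 := hπ (k + 1)
  -- Two consecutive windows of `Z` either follow each other in `W`, or cover a prohibition that is
  -- not common and hence closes one of the loops.
  by_cases hsub : IsSubword (block Z k (m + 2)) W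
  · obtain ⟨i, hi⟩ := hsub
    simp only [length_block, getElem_block] at hi
    have hd := hstep i (i + 1) (fun r hr => (hi r (by omega)).symm) (fun r hr => by
      have := hi (r + 1) (by omega)
      push_cast at this
      rw [show k + 1 + (r : ℤ) = k + (r + 1) by ring, ← this]; congr 1; ring)
    have hd' : N ∣ π (k + 1) - (π k + 1) := by
      have := dvd_sub hd.2 hd.1
      ring_nf at this ⊢; exact this
    rcases lt_or_ge (π k + 1) N with hlt | hge
    · exact Or.inl (eq_of_dvd_sub hk1.1 hk1.2 (by omega) hlt hd')
    · right; left
      refine ⟨by omega, Or.inl ?_⟩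
      have : N ∣ π (k + 1) - 0 := by
        have := dvd_add hd' (dvd_refl N)
        rwa [show π (k + 1) - (π k + 1) + N = π (k + 1) - 0 by omega] at this
      exact eq_of_dvd_sub hk1.1 hk1.2 le_rfl hN this
  · obtain ⟨v, hv, hvi⟩ := hV.complete _ hsub
    have hor : IsSubword v (loop W p) ∨ IsSubword v (other W N p) := by
      by_contra! hc
      exact hZ v (mem_common.2 ⟨hv, hc⟩) ((isSubword_block _ _ _).of_infix hvi)
    rcases hor with hs | hs
    · obtain ⟨h1, h2⟩ := hV.window_of_loop h hv hs hvi
      have hd := hstep (p - 1) 0 h1 (by simpa using h2)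
      exact Or.inr (Or.inr ⟨eq_of_dvd_sub hk.1 hk.2 (by omega) (by omega) hd.1,
        eq_of_dvd_sub hk1.1 hk1.2 le_rfl hN hd.2⟩)
    · obtain ⟨h1, h2⟩ := (hV.shift p).window_of_loop h.symm hv hs hvi
      have hd := hstep (N - 1) p (fun r hr => by rw [h1 r hr]; congr 1; ring)
        (fun r hr => by rw [h2 r hr, add_comm])
      exact Or.inr (Or.inl ⟨eq_of_dvd_sub hk.1 hk.2 (by omega) (by omega) hd.1,
        Or.inr (eq_of_dvd_sub hk1.1 hk1.2 (by omega) (by omega) hd.2)⟩)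

/-- While a walk stays in the first loop, it runs through it periodically. -/
theorem walk_dvd (h : Split W N p m) {π : ℤ → ℤ}
    (hπ : ∀ k, π (k + 1) = π k + 1 ∨ (π k = N - 1 ∧ (π (k + 1) = 0 ∨ π (k + 1) = p)) ∨
        (π k = p - 1 ∧ π (k + 1) = 0)) (k : ℤ) (n : ℕ)
    (hlt : ∀ j, k ≤ j → j ≤ k + n → π j < p) : p ∣ π (k + n) - π k - n := by
  induction n with
  | zero => simp
  | succ n ih =>
    have h1 := ih fun j h1 h2 => hlt j h1 (by push_cast; omega)
    have h2 := hπ (k + n)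
    have h3 := hlt (k + n) (by omega) (by push_cast; omega)
    have h4 := hlt (k + n + 1) (by omega) (by push_cast; omega)
    have hpN := h.lt
    push_cast
    rw [← add_assoc]
    rcases h2 with h2 | ⟨h2, -⟩ | ⟨h2, h2'⟩
    · rw [h2]; ring_nf at h1 ⊢; exact h1
    · omega
    · rw [h2']
      have := dvd_sub h1 (dvd_refl p)
      rw [h2] at this
      ring_nf at this ⊢; exact this

end Prohibitions

/-! ### Systems that determine one loop. -/

namespace Prohibitions

variable {X : Type*} {W : ℤ → X} {N p : ℤ} {m : ℕ} {V : Finset (List X)}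

open Split (other)

theorem common_comm (V : Finset (List X)) (Y₁ Y₂ : ℤ → X) : common V Y₁ Y₂ = common V Y₂ Y₁ := by
  ext v
  simp only [mem_common]
  tauto

theorem Split.not_isSubword_other (h : Split W N p m) {v : List X} (hl : v.length = m + 1)
    (hv : IsSubword v (loop W p)) : ¬ IsSubword v (other W N p) := by
  obtain ⟨k, hk⟩ := hv.exists_eq_block
  have : v = block W (k % p) (m + 1) := by
    rw [hk, hl]
    exact block_eq_iff.2 fun r hr => h.loop_window_le k (by omega)
  rw [this]
  exact h.block_not_isSubword_other (Int.emod_nonneg k h.pos.ne') (Int.emod_lt_of_pos k h.pos)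

/-- On an interval where no window belongs to the second loop, a sequence without common
prohibitions is a shift of the first loop. -/
theorem exists_agree_loop (h : Split W N p m) (hV : IsMinimalForbidden V W) {Z : ℤ → X}
    (hZ : Satisfies Z (common V (loop W p) (other W N p))) (I : Set ℤ) [I.OrdConnected]
    (hI : ∀ j ∈ I, ¬ IsSubword (block Z j (m + 1)) (other W N p)) :
    ∃ c : ℤ, ∀ j ∈ I, ∀ r : ℕ, r ≤ m → Z (j + r) = loop W p (j + r + c) := by
  obtain ⟨π, hπ⟩ := exists_walk h hV hZ
  rcases I.eq_empty_or_nonempty with rfl | ⟨k, hk⟩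
  · exact ⟨0, by simp⟩
  have hlt : ∀ j ∈ I, π j < p := by
    intro j hj
    by_contra! hge
    apply hI j hj
    rw [show block Z j (m + 1) = block W (π j) (m + 1) from
      block_eq_iff.2 fun r hr => (hπ j).2.1 r (by omega)]
    exact h.block_isSubword_other hge (hπ j).1.2
  have hd : ∀ j ∈ I, p ∣ π j - (j + (π k - k)) := by
    intro j hj
    rcases le_total k j with hle | hle
    · obtain ⟨n, rfl⟩ : ∃ n : ℕ, j = k + n := ⟨(j - k).toNat, by omega⟩
      have := walk_dvd h (fun k => (hπ k).2.2) k n fun i h1 h2 =>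
        hlt i (Set.OrdConnected.out ‹_› hk hj ⟨h1, h2⟩)
      ring_nf at this ⊢; exact this
    · obtain ⟨n, rfl⟩ : ∃ n : ℕ, k = j + n := ⟨(k - j).toNat, by omega⟩
      have := walk_dvd h (fun k => (hπ k).2.2) j n fun i h1 h2 =>
        hlt i (Set.OrdConnected.out ‹_› hj hk ⟨h1, h2⟩)
      rw [dvd_sub_comm]
      ring_nf at this ⊢; exact this
  refine ⟨π k - k, fun j hj r hr => ?_⟩
  have h1 : π j % p = π j := Int.emod_eq_of_lt (hπ j).1.1 (hlt j hj)
  rw [(hπ j).2.1 r hr]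
  have h2 := h.loop_window_le (π j) hr
  rw [h1] at h2
  rw [← h2]
  apply apply_eq_of_dvd (loop_periodic W p)
  have := hd j hj
  ring_nf at this ⊢; exact this

/-- The second arc can only be entered at `p` and left at `N - 1`. A walk that meets it therefore
traverses all of it, so missing one window `i₀` means never leaving the first arc. -/
theorem sameWord_loop (h : Split W N p m) (hV : IsMinimalForbidden V W) {Z : ℤ → X}
    (hZ : Satisfies Z (common V (loop W p) (other W N p))) {i₀ : ℤ} (h0 : p ≤ i₀) (h1 : i₀ < N)
    (hi : ¬ IsSubword (block W i₀ (m + 1)) Z) : SameWord (loop W p) Z := by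
  obtain ⟨π, hπ⟩ := exists_walk h hV hZ
  have hp := h.pos
  have hpN := h.lt
  have hne : ∀ k, π k ≠ i₀ := by
    rintro k rfl
    apply hi
    rw [show block W (π k) (m + 1) = block Z k (m + 1) from
      block_eq_iff.2 fun r hr => ((hπ k).2.1 r (by omega)).symm]
    exact isSubword_block _ _ _
  have hlt : ∀ k, π k < p := by
    intro k
    by_contra! hge
    have hk := (hπ k).1
    -- Inside `[p, N)` the walk is forced in both directions, so from `π k` it reaches `i₀` forwards
    -- or backwards.
    have hfw : ∀ n : ℕ, π k + n < N → π (k + n) = π k + n := by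
      intro n
      induction n with
      | zero => simp
      | succ n ih =>
        intro hn
        push_cast at hn ⊢
        have := (hπ (k + n)).2.2
        rw [ih (by omega), add_assoc k] at this
        omega
    have hbw : ∀ n : ℕ, p ≤ π k - n → π (k - n) = π k - n := by
      intro n
      induction n with
      | zero => simp
      | succ n ih =>
        intro hn
        push_cast at hn ⊢
        have := (hπ (k - (n + 1))).2.2
        rw [show k - ((n : ℤ) + 1) + 1 = k - n by ring, ih (by omega)] at this
        omega
    rcases le_total (π k) i₀ with hle | hle
    · exact hne (k + (i₀ - π k).toNat) (by rw [hfw _ (by omega)]; omega)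
    · exact hne (k - (π k - i₀).toNat) (by rw [hbw _ (by omega)]; omega)
  obtain ⟨c, hc⟩ := exists_agree_loop h hV hZ Set.univ fun j _ => by
    rw [show block Z j (m + 1) = block W (π j) (m + 1) from
      block_eq_iff.2 fun r hr => (hπ j).2.1 r (by omega)]
    exact h.block_not_isSubword_other (hπ j).1.1 (hlt j)
  exact ⟨c, fun i => by simpa using hc i trivial 0 (by omega)⟩

theorem determines_loop (h : Split W N p m) (hV : IsMinimalForbidden V W) {V' : Finset (List X)}
    (hV' : ∀ v ∈ common V (loop W p) (other W N p), ∃ v' ∈ V', v' <:+: v)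
    (hs : Satisfies (loop W p) V') {q : List X} (hq : q ∈ V') (hqW : IsSubword q W)
    (hl : q.length ≤ m + 1) : Determines V' (loop W p) := by
  refine ⟨hs, fun Z hZ => ?_⟩
  obtain ⟨i, h0, h1, hi⟩ := h.exists_window hl hqW (hs q hq)
  refine sameWord_loop h hV (fun v hv hvZ => ?_) h0 h1 fun hc => hZ q hq (hc.of_infix hi)
  obtain ⟨v', hv', hvv⟩ := hV' v hv
  exact hZ v' hv' (hvZ.of_infix hvv)

/-- Closing the loop passes from window `p - 1` straight to window `0`. Since `p < N`, these are not
consecutive in `W`, so the block covering both is forbidden. -/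
theorem exists_mem_isSubword_loop (h : Split W N p m) (hV : IsMinimalForbidden V W) :
    ∃ v ∈ V, IsSubword v (loop W p) := by
  have hp := h.pos
  have hpN := h.lt
  have hq : ¬ IsSubword (block (loop W p) (p - 1) (m + 2)) W := by
    rintro ⟨k, hk⟩
    simp only [length_block, getElem_block] at hk
    have h1 := h.inj k (p - 1) fun r hr => by
      rw [hk r (by omega), h.loop_window_le _ hr, Int.emod_eq_of_lt (by omega) (by omega)]
    have h2 := h.inj (k + 1) 0 fun r hr => by
      have := hk (r + 1) (by omega)
      push_cast at this
      rw [show k + 1 + (r : ℤ) = k + (r + 1) by ring, this,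
        show p - 1 + ((r : ℤ) + 1) = p + r by ring, h.loop_window_le _ hr]
      simp
    have h3 := dvd_sub h2 h1
    rw [show k + 1 - 0 - (k - (p - 1)) = p by ring] at h3
    have := Int.le_of_dvd hp h3
    omega
  obtain ⟨v, hv, hvq⟩ := hV.complete _ hq
  exact ⟨v, hv, (isSubword_block _ _ _).of_infix hvq⟩

/-- Each loop violates some prohibition. The two are different because such a word has length at
least `m + 1`, and no word of length `m + 1` lies in both loops. -/
theorem card_common (h : Split W N p m) (hV : IsMinimalForbidden V W) :
    (common V (loop W p) (other W N p)).card + 2 ≤ V.card := by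
  classical
  obtain ⟨v₁, hv₁, hs₁⟩ := exists_mem_isSubword_loop h hV
  obtain ⟨v₂, hv₂, hs₂⟩ := exists_mem_isSubword_loop h.symm (hV.shift p)
  have hne : v₁ ≠ v₂ := by
    rintro rfl
    have hl : m + 1 ≤ v₁.length := by
      by_contra hlt
      exact hV.avoid _ hv₁ (h.isSubword_of_loop hs₁ (by omega))
    have ht := (List.take_prefix (m + 1) v₁).isInfix
    exact h.not_isSubword_other (by simpa using hl) (hs₁.of_infix ht) (hs₂.of_infix ht)
  have hsub : insert v₁ (insert v₂ (common V (loop W p) (other W N p))) ⊆ V := by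
    intro v hv
    simp only [Finset.mem_insert] at hv
    rcases hv with rfl | rfl | hv
    exacts [hv₁, hv₂, (mem_common.1 hv).1]
  have := Finset.card_le_card hsub
  rwa [Finset.card_insert_of_notMem, Finset.card_insert_of_notMem] at this
  · exact fun hc => (mem_common.1 hc).2.2 hs₂
  · simp only [Finset.mem_insert, not_or]
    exact ⟨hne, fun hc => (mem_common.1 hc).2.1 hs₁⟩

theorem exists_determines_loop (h : Split W N p m) (hV : IsMinimalForbidden V W) :
    ∃ V', Determines V' (loop W p) ∧ V'.card + 1 ≤ V.card := by
  classical
  have hcard := card_common h hV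
  have hpN := h.lt
  refine ⟨insert (block W p (m + 1)) (common V (loop W p) (other W N p)),
    determines_loop h hV (fun v hv => ⟨v, Finset.mem_insert_of_mem hv, List.infix_rfl⟩) ?_
      (Finset.mem_insert_self _ _) (isSubword_block _ _ _) (by simp),
    (Nat.add_le_add_right (Finset.card_insert_le _ _) 1).trans hcard⟩
  intro v hv
  rcases Finset.mem_insert.1 hv with rfl | hv
  · exact h.block_not_isSubword_loop le_rfl hpN
  · exact (mem_common.1 hv).2.1

/-- Here `v'` does two jobs. It implies the prohibition `v`, and, since it occurs in `W` but not in
the first loop, it blocks the second arc. So nothing is added to the common prohibitions. -/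
theorem exists_determines_loop_of_proper (h : Split W N p m) (hV : IsMinimalForbidden V W)
    {v v' : List X} (hv : v ∈ common V (loop W p) (other W N p)) (hvv : v' <:+: v) (hne : v' ≠ v)
    (hn : ¬ IsSubword v' (loop W p)) : ∃ V', Determines V' (loop W p) ∧ V'.card + 2 ≤ V.card := by
  classical
  have hcard := card_common h hV
  have hvV := (mem_common.1 hv).1
  have hlen := hV.length_le h hvV
  have hlt : v'.length < v.length :=
    lt_of_le_of_ne hvv.length_le fun he => hne (hvv.eq_of_length he)
  refine ⟨insert v' ((common V (loop W p) (other W N p)).erase v),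
    determines_loop h hV (fun w hw => ?_) ?_ (Finset.mem_insert_self _ _)
      (hV.proper v hvV v' hvv hne) (by omega), ?_⟩
  · by_cases hwv : w = v
    · exact ⟨v', Finset.mem_insert_self _ _, hwv ▸ hvv⟩
    · exact ⟨w, Finset.mem_insert_of_mem (Finset.mem_erase.2 ⟨hwv, hw⟩), List.infix_rfl⟩
  · intro w hw
    rcases Finset.mem_insert.1 hw with rfl | hw
    · exact hn
    · exact (mem_common.1 (Finset.mem_of_mem_erase hw)).2.1
  · have h1 := Finset.card_insert_le v' ((common V (loop W p) (other W N p)).erase v)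
    rw [Finset.card_erase_add_one hv] at h1
    omega

end Prohibitions

/-! ### Gluing the loops along a shortest distinguishing word. -/

namespace Prohibitions

variable {X : Type*} {W : ℤ → X} {N p : ℤ} {m : ℕ} {V : Finset (List X)}

open Split (other)

theorem eq_of_periodic_of_nonpos {f g : ℤ → X} {p : ℤ} (hp : 0 < p) (hf : ∀ i, f (i + p) = f i)
    (hg : ∀ i, g (i + p) = g i) (h : ∀ i ≤ 0, f i = g i) : f = g := by
  funext i
  have h1 := Int.emod_lt_of_pos i hp
  have hd : p ∣ i - (i % p - p) := by
    rw [show i - (i % p - p) = (i - i % p) + p by ring]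
    exact dvd_add Int.dvd_self_sub_emod dvd_rfl
  rw [apply_eq_of_dvd hf hd, apply_eq_of_dvd hg hd, h _ (by omega)]

theorem eq_of_periodic_of_pos {f g : ℤ → X} {p : ℤ} (hp : 0 < p) (hf : ∀ i, f (i + p) = f i)
    (hg : ∀ i, g (i + p) = g i) (h : ∀ i ≥ 1, f i = g i) : f = g := by
  funext i
  have h1 := Int.emod_nonneg i hp.ne'
  have hd : p ∣ i - (i % p + p) := by
    rw [show i - (i % p + p) = (i - i % p) - p by ring]
    exact dvd_sub Int.dvd_self_sub_emod dvd_rfl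
  rw [apply_eq_of_dvd hf hd, apply_eq_of_dvd hg hd, h _ (by omega)]

theorem exists_nat_cast_of_mem {L : ℕ} {i : ℤ} (h0 : 0 ≤ i) (h1 : i ≤ L) :
    ∃ r : ℕ, r ≤ L ∧ (r : ℤ) = i := ⟨i.toNat, by omega, by omega⟩

/-- The two loops cannot both contain all proper subwords of all common prohibitions. -/
theorem false_of_proper_subwords (h : Split W N p m) (hV : IsMinimalForbidden V W)
    (hs : ∀ v ∈ common V (loop W p) (other W N p), ∀ v', v' <:+: v → v' ≠ v →
      IsSubword v' (loop W p))
    (ht : ∀ v ∈ common V (loop W p) (other W N p), ∀ v', v' <:+: v → v' ≠ v →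
      IsSubword v' (other W N p))
    {L : ℕ} (hL : L + 1 ≤ m) {k : ℤ} (hk : ¬ IsSubword (block (loop W p) k (L + 2)) (other W N p))
    (hmin : ∀ v : List X, v.length < L + 2 →
      (IsSubword v (loop W p) ↔ IsSubword v (other W N p))) : False := by
  classical
  have hp := h.pos
  set S := loop W p with hS
  set T := other W N p with hT
  have hSp : ∀ i, S (i + p) = S i := loop_periodic W p
  set v := block S k (L + 2) with hv
  have hvS : IsSubword v S := isSubword_block _ _ _
  -- By minimality both proper ends of `v` occur in `T`: at `j₁` all but the last letter, at `j₂`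
  -- all but the first. As `v` is not in `T`, the missing letter differs each time (`hy`, `hx`).
  obtain ⟨j₁, hj₁⟩ : ∃ j, ∀ i : ℤ, 0 ≤ i → i ≤ L → T (j + i) = S (k + i) := by
    obtain ⟨j, hj⟩ := (hmin (block S k (L + 1)) (by simp)).1 (isSubword_block _ _ _)
    simp only [length_block, getElem_block] at hj
    refine ⟨j, fun i h0 h1 => ?_⟩
    obtain ⟨r, hr, rfl⟩ := exists_nat_cast_of_mem h0 h1
    exact hj r (by omega)
  obtain ⟨j₂, hj₂⟩ : ∃ j, ∀ i : ℤ, 1 ≤ i → i ≤ L + 1 → T (j + i) = S (k + i) := by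
    obtain ⟨j, hj⟩ := (hmin (block S (k + 1) (L + 1)) (by simp)).1 (isSubword_block _ _ _)
    simp only [length_block, getElem_block] at hj
    refine ⟨j - 1, fun i h0 h1 => ?_⟩
    obtain ⟨r, hr, hri⟩ := exists_nat_cast_of_mem (i := i - 1) (L := L) (by omega) (by omega)
    have := hj r (by omega)
    rw [hri] at this
    ring_nf at this ⊢; exact this
  have hy : T (j₁ + (L + 1)) ≠ S (k + (L + 1)) := by
    intro he
    refine hk (isSubword_congr_of_agree (k' := j₁) fun r hr => ?_)
    rcases Nat.lt_or_ge r (L + 1) with h1 | h1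
    · exact (hj₁ r (by omega) (by omega)).symm
    · obtain rfl : r = L + 1 := by omega
      push_cast; exact he.symm
  have hx : T j₂ ≠ S k := by
    intro he
    refine hk (isSubword_congr_of_agree (k' := j₂) fun r hr => ?_)
    rcases Nat.eq_zero_or_pos r with rfl | h1
    · simpa using he.symm
    · exact (hj₂ r (by omega) (by omega)).symm
  -- Gluing across a seam equal to `v` creates no common prohibition. One containing `v` properly
  -- would put `v` in `T`, and `v` itself is not one because it occurs in `S`.
  have hsat : ∀ {Y₁ Y₂ G : ℤ → X}, (∀ u, IsSubword u Y₁ → IsSubword u S ∨ IsSubword u T) →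
      (∀ u, IsSubword u Y₂ → IsSubword u S ∨ IsSubword u T) → (∀ i : ℤ, i ≤ L → G i = Y₁ i) →
      (∀ i : ℤ, 1 ≤ i → G i = Y₂ i) → block G 0 (L + 2) = v → Satisfies G (common V S T) := by
    intro Y₁ Y₂ G hY₁ hY₂ hG₁ hG₂ hGv w hw hwG
    have hw' := (mem_common.1 hw).2
    rcases isSubword_glue hG₁ hG₂ hwG with h1 | h1 | h1
    · exact (hY₁ _ h1).elim hw'.1 hw'.2
    · exact (hY₂ _ h1).elim hw'.1 hw'.2
    · rw [hGv] at h1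
      by_cases he : v = w
      · exact hw'.1 (he ▸ hvS)
      · exact hk (ht w hw v h1 he)
  have hwinv : ∀ {G : ℤ → X}, block G 0 (L + 2) = v → ∀ j : ℤ, j ≤ 0 → L + 1 ≤ j + m →
      ¬ IsSubword (block G j (m + 1)) T := by
    intro G hGv j h0 h1 hc
    apply hk
    rw [← hGv]
    exact hc.of_infix (block_infix_block _ h0 (by push_cast; omega))
  have hwinS : ∀ {G : ℤ → X} {j c : ℤ}, (∀ i, j ≤ i → i ≤ j + m → G i = S (i + c)) →
      ¬ IsSubword (block G j (m + 1)) T := fun {G j c} hj =>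
    h.not_isSubword_other (by simp) (isSubword_congr_of_agree (k' := j + c) fun r hr => by
      rw [hj _ (by omega) (by omega)]; exact congrArg S (by ring))
  -- Glue `S` on the left to `T` on the right with seam `v`. Windows starting at or before `0`
  -- either contain `v` or lie in the `S` half, so none is a window of `T`, and the sequence follows
  -- `S` past the seam. Hence in `S` the first `L + 1` letters of `v` force its last letter.
  have case₁ : ∀ i₁, (∀ i : ℤ, 0 ≤ i → i ≤ L → S (i₁ + i) = S (k + i)) →
      S (i₁ + (L + 1)) = S (k + (L + 1)) := by
    intro i₁ hi₁
    obtain ⟨G, hG₁, hG₂⟩ := exists_glue (fun i => S (i + i₁)) (fun i => T (i + j₂)) L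
      fun i h1 h2 => by
        rw [add_comm, hi₁ i (by omega) h2, add_comm i j₂, hj₂ i h1 (by omega)]
    have hGv : block G 0 (L + 2) = v := by
      refine block_eq_iff.2 fun r hr => ?_
      rw [zero_add]
      rcases Nat.lt_or_ge r (L + 1) with h1 | h1
      · rw [hG₁ _ (by omega), add_comm, hi₁ r (by omega) (by omega)]
      · rw [hG₂ _ (by omega), add_comm, hj₂ r (by omega) (by omega)]
    have hG := hsat (fun u hu => Or.inl ((isSubword_shift _).1 hu))
      (fun u hu => Or.inr ((isSubword_shift _).1 hu)) hG₁ hG₂ hGv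
    obtain ⟨c, hc⟩ := exists_agree_loop h hV hG (Set.Iic 0) fun j hj => by
      rcases le_or_gt ((L : ℤ) + 1) (j + m) with h1 | h1
      · exact hwinv hGv j hj h1
      · exact hwinS fun i _ hi => hG₁ i (by omega)
    have heq := eq_of_periodic_of_nonpos (f := fun i => S (i + i₁)) (g := fun i => S (i + c)) hp
      (fun i => by rw [← hSp (i + i₁)]; ring_nf) (fun i => by rw [← hSp (i + c)]; ring_nf)
      (fun i hi => by rw [← hG₁ i (by omega)]; simpa using hc i hi 0 (by omega))
    have h1 := hc 0 (by simp) (L + 1) hL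
    have h2 := congrFun heq (L + 1)
    push_cast at h1
    rw [zero_add, hG₂ _ (by omega)] at h1
    rw [add_comm, h2, ← hj₂ (L + 1) (by omega) le_rfl, add_comm j₂, h1]
  -- The mirror image, with `T` on the left: in `S` the last `L + 1` letters of `v` force its first
  -- letter.
  have case₂ : ∀ i₁, (∀ i : ℤ, 1 ≤ i → i ≤ L + 1 → S (i₁ + i) = S (k + i)) → S i₁ = S k := by
    intro i₁ hi₁
    obtain ⟨G, hG₁, hG₂⟩ := exists_glue (fun i => T (i + j₁)) (fun i => S (i + i₁)) L
      fun i h1 h2 => by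
        rw [add_comm, hj₁ i (by omega) h2, add_comm i i₁, hi₁ i h1 (by omega)]
    have hGv : block G 0 (L + 2) = v := by
      refine block_eq_iff.2 fun r hr => ?_
      rw [zero_add]
      rcases Nat.lt_or_ge r (L + 1) with h1 | h1
      · rw [hG₁ _ (by omega), add_comm, hj₁ r (by omega) (by omega)]
      · rw [hG₂ _ (by omega), add_comm, hi₁ r (by omega) (by omega)]
    have hG := hsat (fun u hu => Or.inr ((isSubword_shift _).1 hu))
      (fun u hu => Or.inl ((isSubword_shift _).1 hu)) hG₁ hG₂ hGv
    obtain ⟨c, hc⟩ := exists_agree_loop h hV hG (Set.Ici (L + 1 - m)) fun j hj => by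
      simp only [Set.mem_Ici] at hj
      rcases le_or_gt j 0 with h1 | h1
      · exact hwinv hGv j h1 (by omega)
      · exact hwinS fun i hi _ => hG₂ i (by omega)
    have heq := eq_of_periodic_of_pos (f := fun i => S (i + i₁)) (g := fun i => S (i + c)) hp
      (fun i => by rw [← hSp (i + i₁)]; ring_nf) (fun i => by rw [← hSp (i + c)]; ring_nf)
      (fun i hi => by
        rw [← hG₂ i hi]
        simpa using hc i (by simp only [Set.mem_Ici]; omega) 0 (by omega))
    have h1 := hc 0 (by simp only [Set.mem_Ici]; omega) 0 (by omega)
    have h2 := congrFun heq 0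
    have h3 := hj₁ 0 le_rfl (by omega)
    simp only [Nat.cast_zero, add_zero, zero_add] at h1 h2 h3
    rw [hG₁ _ (by omega)] at h1
    simp only [zero_add] at h1
    exact h2.trans (h1.symm.trans h3)
  have hv₁ : ¬ IsSubword (block T j₁ (L + 2)) S := by
    rintro ⟨i₁, hi₁⟩
    simp only [length_block, getElem_block] at hi₁
    have := case₁ i₁ fun i h0 h1 => by
      obtain ⟨r, hr, rfl⟩ := exists_nat_cast_of_mem h0 h1
      rw [hi₁ r (by omega), hj₁ r h0 h1]
    apply hy
    rw [← this]
    have := hi₁ (L + 1) (by omega)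
    push_cast at this
    exact this.symm
  have hv₂ : ¬ IsSubword (block T j₂ (L + 2)) S := by
    rintro ⟨i₁, hi₁⟩
    simp only [length_block, getElem_block] at hi₁
    have := case₂ i₁ fun i h0 h1 => by
      obtain ⟨r, hr, rfl⟩ := exists_nat_cast_of_mem (i := i) (L := L + 1) (by omega) (by omega)
      rw [hi₁ r (by omega), hj₂ r h0 h1]
    apply hx
    rw [← this]
    simpa using (hi₁ 0 (by omega)).symm
  -- Now glue `S` to itself so that the seam is the word of `T` at `j₂`, which `case₂` excludes from
  -- `S`.
  obtain ⟨i₃, hi₃⟩ := (hmin (block T j₂ (L + 1)) (by simp)).2 (isSubword_block _ _ _)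
  simp only [length_block, getElem_block] at hi₃
  obtain ⟨G, hG₁, hG₂⟩ := exists_glue (fun i => S (i + i₃)) (fun i => S (i + k)) L
      fun i h1 h2 => by
        obtain ⟨r, hr, rfl⟩ := exists_nat_cast_of_mem (i := i) (L := L) (by omega) (by omega)
        rw [add_comm, hi₃ r (by omega), hj₂ r h1 (by omega), add_comm]
  have hGv : block G 0 (L + 2) = block T j₂ (L + 2) := by
    refine block_eq_iff.2 fun r hr => ?_
    rw [zero_add]
    rcases Nat.lt_or_ge r (L + 1) with h1 | h1
    · rw [hG₁ _ (by omega), add_comm, hi₃ r (by omega)]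
    · rw [hG₂ _ (by omega), add_comm, hj₂ r (by omega) (by omega)]
  -- The word of `T` at `j₁` together with the common prohibitions determines `S`. The glued
  -- sequence obeys this system too, yet it contains a word missing from `S`.
  have hdet : Determines (insert (block T j₁ (L + 2)) (common V S T)) S := by
    refine determines_loop h hV (fun w hw => ⟨w, Finset.mem_insert_of_mem hw, List.infix_rfl⟩) ?_
      (Finset.mem_insert_self _ _) (h.isSubword_of_other (isSubword_block _ _ _) ?_) ?_
    · intro w hw
      rcases Finset.mem_insert.1 hw with rfl | hw
      · exact hv₁
      · exact (mem_common.1 hw).2.1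
    · simp; omega
    · simp; omega
  have hG : Satisfies G (insert (block T j₁ (L + 2)) (common V S T)) := by
    intro w hw hwG
    have hwS := hdet.1 w hw
    rcases isSubword_glue hG₁ hG₂ hwG with h1 | h1 | h1
    · exact hwS ((isSubword_shift _).1 h1)
    · exact hwS ((isSubword_shift _).1 h1)
    · rw [hGv] at h1
      rcases Finset.mem_insert.1 hw with rfl | hw
      · have := block_eq_iff.1 (h1.eq_of_length (by simp)) (L + 1) (by omega)
        push_cast at this
        exact hy (this.symm.trans (hj₂ _ (by omega) le_rfl))
      · refine hv₂ (hs w hw _ h1 ?_)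
        rintro rfl
        exact (mem_common.1 hw).2.2 (isSubword_block _ _ _)
  apply hv₂
  rw [← (hdet.2 G hG).isSubword_iff, ← hGv]
  exact isSubword_block _ _ _

end Prohibitions

/-! ### Minimal periods and the Fibonacci recursion. -/

namespace Prohibitions

variable {X : Type*} {W : ℤ → X} {N p : ℤ} {m : ℕ} {V : Finset (List X)}

open Split (other)

/-- `N` is the minimal period of `W`. -/
structure IsMinimalPeriod (W : ℤ → X) (N : ℤ) : Prop where
  pos : 0 < N
  periodic : ∀ i, W (i + N) = W i
  dvd : ∀ k, (∀ i, W (i + k) = W i) → N ∣ k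

theorem Split.isMinimalPeriod_loop (h : Split W N p m) : IsMinimalPeriod (loop W p) p :=
  ⟨h.pos, loop_periodic W p, fun k hk => by
    simpa using h.loop_inj (i := k) (j := 0) fun r _ => by rw [zero_add, add_comm, hk]⟩

theorem IsMinimalPeriod.shift (h : IsMinimalPeriod W N) (c : ℤ) :
    IsMinimalPeriod (fun i => W (i + c)) N :=
  ⟨h.pos, fun i => by rw [← h.periodic (i + c)]; ring_nf, fun k hk => h.dvd k fun i => by
    have := hk (i - c)
    ring_nf at this ⊢; exact this⟩

/-- A sequence over two letters that misses one of them is constant. -/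
theorem IsMinimalPeriod.eq_one_of_not_isSubword (hX : ∀ x y z : X, x ≠ y → z ≠ y → x = z)
    (hp : IsMinimalPeriod W p) {v : List X} (hl : v.length ≤ 1) (hv : ¬ IsSubword v W) :
    p = 1 := by
  match v with
  | [] => exact absurd ⟨0, by simp⟩ hv
  | _ :: _ :: _ => simp at hl
  | [x] =>
    have hx : ∀ i, W i ≠ x := fun i hi => hv ⟨i, fun j hj => by
      have : j = 0 := by simpa using hj
      subst this; simpa using hi⟩
    have := Int.le_of_dvd one_pos (hp.dvd 1 fun i => hX _ x _ (hx _) (hx _))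
    have := hp.pos
    omega

/-- Period 1 has to be set aside because the gluing argument needs a distinguishing word of length
at least 2. Over two letters, a loop that misses a letter is constant. -/
theorem exists_determines_loop_or_other (hX : ∀ x y z : X, x ≠ y → z ≠ y → x = z)
    (h : Split W N p m) (hV : IsMinimalForbidden V W) :
    (∃ V', Determines V' (loop W p) ∧ V'.card + 2 ≤ V.card) ∨
    (∃ V', Determines V' (other W N p) ∧ V'.card + 2 ≤ V.card) ∨ p = 1 ∨ N - p = 1 := by
  by_contra! hc
  obtain ⟨hc₁, hc₂, hp1, hq1⟩ := hc
  have hs : ∀ v ∈ common V (loop W p) (other W N p), ∀ v', v' <:+: v → v' ≠ v →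
      IsSubword v' (loop W p) := by
    intro v hv v' hvv hne
    by_contra hn
    obtain ⟨V', h1, h2⟩ := exists_determines_loop_of_proper h hV hv hvv hne hn
    exact absurd h2 (not_le.2 (hc₁ V' h1))
  have ht : ∀ v ∈ common V (loop W p) (other W N p), ∀ v', v' <:+: v → v' ≠ v →
      IsSubword v' (other W N p) := by
    intro v hv v' hvv hne
    by_contra hn
    rw [common_comm, ← h.other_other] at hv
    obtain ⟨V', h1, h2⟩ := exists_determines_loop_of_proper h.symm (hV.shift p) hv hvv hne hn
    exact absurd h2 (not_le.2 (hc₂ V' h1))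
  classical
  have hex : ∃ n, ∃ v : List X, v.length = n ∧
      ¬ (IsSubword v (loop W p) ↔ IsSubword v (other W N p)) := by
    refine ⟨_, block W 0 (m + 1), rfl, fun hiff => ?_⟩
    exact h.block_not_isSubword_other le_rfl h.pos
      (hiff.1 (h.block_isSubword_loop le_rfl h.pos))
  have hle : Nat.find hex ≤ m + 1 := Nat.find_min' hex ⟨block W 0 (m + 1), by simp, fun hiff =>
    h.block_not_isSubword_other le_rfl h.pos
      (hiff.1 (h.block_isSubword_loop le_rfl h.pos))⟩
  obtain ⟨v, hvl, hv⟩ := Nat.find_spec hex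
  have hmin : ∀ u : List X, u.length < v.length →
      (IsSubword u (loop W p) ↔ IsSubword u (other W N p)) := by
    intro u hu
    by_contra hn
    exact Nat.find_min hex (hvl ▸ hu) ⟨u, rfl, hn⟩
  rw [← hvl] at hle
  have hlen : 2 ≤ v.length := by
    by_contra hlt
    by_cases hvs : IsSubword v (loop W p)
    · have hvt : ¬ IsSubword v (other W N p) := fun hvt => hv (by tauto)
      exact hq1 (IsMinimalPeriod.eq_one_of_not_isSubword hX h.symm.isMinimalPeriod_loop (by omega) hvt)
    · exact hp1 (IsMinimalPeriod.eq_one_of_not_isSubword hX h.isMinimalPeriod_loop (by omega) hvs)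
  obtain ⟨L, hL⟩ : ∃ L, v.length = L + 2 := ⟨v.length - 2, by omega⟩
  rw [hL] at hmin hle
  by_cases hvs : IsSubword v (loop W p)
  · have hvt : ¬ IsSubword v (other W N p) := fun hvt => hv (by tauto)
    obtain ⟨k, hk⟩ := hvs.exists_eq_block
    rw [hk, hL] at hvt
    exact false_of_proper_subwords h hV hs ht (by omega) hvt hmin
  · have hvt : IsSubword v (other W N p) := by tauto
    obtain ⟨k, hk⟩ := hvt.exists_eq_block
    rw [hk, hL, ← h.other_other] at hvs
    rw [common_comm, ← h.other_other] at hs ht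
    refine false_of_proper_subwords h.symm (hV.shift p) ht hs (by omega) hvs fun u hu => ?_
    rw [h.other_other]
    exact (hmin u hu).symm

theorem exists_split (h : IsMinimalPeriod W N) (hN : N ≠ 1) :
    ∃ (c p : ℤ) (m : ℕ), Split (fun i => W (i + c)) N p m := by
  classical
  have hpos := h.pos
  -- Length `N` suffices: equal windows of a full period make `i - j` a period of `W`.
  have hex : ∃ M : ℕ, ∀ i j : ℤ, (∀ r : ℕ, r < M → W (i + r) = W (j + r)) → N ∣ i - j := by
    refine ⟨N.toNat, fun i j hij => h.dvd _ fun k => ?_⟩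
    have h1 := Int.emod_nonneg (k - j) hpos.ne'
    have h2 := Int.emod_lt_of_pos (k - j) hpos
    have h3 := hij ((k - j) % N).toNat (by omega)
    rw [Int.toNat_of_nonneg h1] at h3
    have h4 : N ∣ k - j - (k - j) % N := Int.dvd_self_sub_emod
    calc W (k + (i - j)) = W (i + (k - j) % N) :=
          apply_eq_of_dvd h.periodic (by ring_nf at h4 ⊢; exact h4)
      _ = W (j + (k - j) % N) := h3
      _ = W k := (apply_eq_of_dvd h.periodic (by ring_nf at h4 ⊢; exact h4)).symm
  obtain ⟨m, hm⟩ : ∃ m, Nat.find hex = m + 1 := by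
    refine Nat.exists_eq_succ_of_ne_zero fun h0 => hN ?_
    have := Nat.find_spec hex
    rw [h0] at this
    have := Int.le_of_dvd one_pos (by simpa using this 1 0 (by simp))
    omega
  have hspec := Nat.find_spec hex
  have hmin := Nat.find_min hex (m := m) (by omega)
  rw [hm] at hspec
  push Not at hmin
  obtain ⟨i, j, hij, hnd⟩ := hmin
  have h1 := Int.emod_nonneg (i - j) hpos.ne'
  have h2 : (i - j) % N ≠ 0 := fun h0 => hnd (Int.dvd_of_emod_eq_zero h0)
  refine ⟨j, (i - j) % N, m, by omega, Int.emod_lt_of_pos _ hpos, (h.shift j).periodic,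
    fun i' j' hr => ?_, fun r hr => ?_⟩
  · have := hspec (i' + j) (j' + j) fun r hr' => by
      have := hr r (by omega)
      ring_nf at this ⊢; exact this
    simpa using this
  · have h4 : N ∣ i - j - (i - j) % N := Int.dvd_self_sub_emod
    rw [add_comm (r : ℤ), ← hij r hr]
    refine (apply_eq_of_dvd h.periodic ?_).symm
    ring_nf at h4 ⊢; exact h4

theorem Determines.of_sameWord {W W' : ℤ → X} (hV : Determines V W) (h : SameWord W W') :
    Determines V W' := by
  refine ⟨fun v hv hs => hV.1 v hv (h.isSubword_iff.1 hs), fun Z hZ => ?_⟩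
  obtain ⟨c, hc⟩ := h
  obtain ⟨d, hd⟩ := hV.2 Z hZ
  exact ⟨d - c, fun i => by rw [hd, hc]; ring_nf⟩

theorem F_add_two (n : ℕ) : F (n + 2) = F n + F (n + 1) := Nat.fib_add_two

theorem F_pos (n : ℕ) : 0 < F n := Nat.fib_pos.2 n.succ_pos

theorem F_mono : Monotone F := fun _ _ h => Nat.fib_mono (Nat.succ_le_succ h)

theorem period_le_F (hX : ∀ x y z : X, x ≠ y → z ≠ y → x = z) (n : ℕ) : ∀ (N : ℤ) (W : ℤ → X)
    (V : Finset (List X)), N ≤ n → IsMinimalPeriod W N → Determines V W → N ≤ F V.card := by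
  induction n with
  | zero => intro N W V hN hW; have := hW.pos; omega
  | succ n ih =>
    intro N W V hN hW hV
    have hFV := F_pos V.card
    by_cases hN1 : N = 1
    · omega
    obtain ⟨c, p, m, h⟩ := exists_split hW hN1
    have hV' : Determines V (fun i => W (i + c)) := hV.of_sameWord ⟨c, fun i => rfl⟩
    obtain ⟨V₀, hcard, hV₀⟩ := exists_isMinimalForbidden (fun x => by
      by_contra! hx
      exact hN1 (IsMinimalPeriod.eq_one_of_not_isSubword hX (hW.shift c) (v := [x]) (by simp)
        fun ⟨k, hk⟩ => hx k (by simpa using hk 0 (by simp)))) hV'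
    have hp := h.pos
    have hpN := h.lt
    obtain ⟨V₁, hV₁, hc₁⟩ := exists_determines_loop h hV₀
    obtain ⟨V₂, hV₂, hc₂⟩ := exists_determines_loop h.symm (hV₀.shift p)
    have hcc := card_common h hV₀
    obtain ⟨d, hd⟩ : ∃ d, V₀.card = d + 2 := ⟨V₀.card - 2, by omega⟩
    have ihs : ∀ {V' : Finset (List X)} {e : ℕ}, Determines V' (loop _ p) → V'.card ≤ e →
        p ≤ F e := fun h1 h2 =>
      (ih p _ _ (by omega) h.isMinimalPeriod_loop h1).trans (by exact_mod_cast F_mono h2)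
    have iht : ∀ {V' : Finset (List X)} {e : ℕ}, Determines V' (other (fun i => W (i + c)) N p) → V'.card ≤ e →
        N - p ≤ F e := fun h1 h2 =>
      (ih (N - p) _ _ (by omega) h.symm.isMinimalPeriod_loop h1).trans
        (by exact_mod_cast F_mono h2)
    have h1 := ihs hV₁ (e := d + 1) (by omega)
    have h2 := iht hV₂ (e := d + 1) (by omega)
    have hF := F_mono hcard
    rw [hd, F_add_two] at hF
    have hFd := F_pos d
    -- In each case one loop has period at most `F d` and the other at most `F (d + 1)`; a loop of
    -- period 1 satisfies the smaller bound because `F d` is positive.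
    rcases exists_determines_loop_or_other hX h hV₀ with ⟨V', h3, h4⟩ | ⟨V', h3, h4⟩ | h3 | h3
    · have := ihs h3 (e := d) (by omega)
      omega
    · have := iht h3 (e := d) (by omega)
      omega
    · omega
    · omega

end Prohibitions

/-! ### Non-periodic words and minimal periods. -/

namespace Prohibitions

variable {X : Type*}

theorem wordPow_succ (v : List X) (n : ℕ) : wordPow v (n + 1) = v ++ wordPow v n := by
  simp [wordPow, List.replicate_succ]

@[simp] theorem length_wordPow (v : List X) (n : ℕ) : (wordPow v n).length = n * v.length := by
  simp [wordPow]

theorem getElem?_wordPow (v : List X) (n i : ℕ) (hi : i < n * v.length) :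
    (wordPow v n)[i]? = v[i % v.length]? := by
  induction n generalizing i with
  | zero => simp at hi
  | succ n ih =>
    rw [wordPow_succ]
    rcases Nat.lt_or_ge i v.length with h | h
    · rw [List.getElem?_append_left h, Nat.mod_eq_of_lt h]
    · rw [List.getElem?_append_right h, ih _ (by rw [add_mul] at hi; omega), Nat.mod_eq_sub_mod h]

theorem periodicWord_periodic (u : List X) (hu : u ≠ []) (i : ℤ) :
    periodicWord u hu (i + u.length) = periodicWord u hu i := by
  simp [periodicWord]

theorem periodicWord_of_lt (u : List X) (hu : u ≠ []) {i : ℕ} (hi : i < u.length) :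
    periodicWord u hu i = u[i] := by
  have : ((i : ℤ) % (u.length : ℤ)).toNat = i := by
    rw [← Int.natCast_mod, Nat.mod_eq_of_lt hi]; simp
  simp [periodicWord, this]

/-- With `k`, also `gcd(k, |u|)` is a period, by Bézout. If it were a proper divisor of `|u|`, then
`u` would be a power of its prefix of that length. -/
theorem isMinimalPeriod_periodicWord {u : List X} (hu : Nonperiodic u) :
    IsMinimalPeriod (periodicWord u hu.1) u.length := by
  have hpos : 0 < u.length := List.length_pos_iff.2 hu.1
  refine ⟨by exact_mod_cast hpos, periodicWord_periodic u hu.1, fun k hk => ?_⟩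
  set P := periodicWord u hu.1 with hP
  have hPp : ∀ i, P (i + u.length) = P i := periodicWord_periodic u hu.1
  set g := Int.gcd k u.length with hg
  obtain ⟨n, hn⟩ : g ∣ u.length := by
    have := Int.gcd_dvd_right k (u.length : ℤ)
    exact_mod_cast this
  have hgp : ∀ i, P (i + g) = P i := fun i => by
    rw [hg, Int.gcd_eq_gcd_ab, ← add_assoc, apply_add_mul hPp,
      apply_add_mul hk]
  have hn0 : n ≠ 0 := by rintro rfl; omega
  have hg0 : 0 < g := Nat.pos_of_ne_zero fun h0 => by rw [h0] at hn; omega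
  rcases eq_or_ne n 1 with rfl | hn1
  · rw [hn, mul_one]
    exact Int.gcd_dvd_left k (u.length : ℤ)
  · exfalso
    have hgl : g ≤ u.length := Nat.le_of_dvd hpos ⟨n, hn⟩
    refine hu.2 ⟨u.take g, n, by omega, ?_⟩
    have hlen : (u.take g).length = g := by simpa using hgl
    apply List.ext_getElem?
    intro i
    rcases Nat.lt_or_ge i u.length with hi | hi
    · have hm := Nat.mod_lt i hg0
      rw [getElem?_wordPow _ _ _ (by rw [hlen, mul_comm, ← hn]; exact hi), hlen,
        List.getElem?_take_of_lt hm, List.getElem?_eq_getElem hi,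
        List.getElem?_eq_getElem (by omega), ← periodicWord_of_lt u hu.1 hi,
        ← periodicWord_of_lt u hu.1 (hm.trans_le hgl)]
      congr 1
      apply apply_eq_of_dvd hgp
      push_cast
      exact Int.dvd_self_sub_emod
    · rw [List.getElem?_eq_none hi, List.getElem?_eq_none]
      rw [length_wordPow, hlen, mul_comm, ← hn]; exact hi

/-- The upper bound for the period of a word determined by a system of prohibitions. -/
theorem length_le_F (hX : ∀ x y z : X, x ≠ y → z ≠ y → x = z) {V : Finset (List X)} {u : List X}
    (hu : Nonperiodic u) (hV : Determines V (periodicWord u hu.1)) : u.length ≤ F V.card := by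
  exact_mod_cast period_le_F hX u.length _ _ V le_rfl (isMinimalPeriod_periodicWord hu) hV

end Prohibitions

/-! ### Prohibitions under the morphism `a ↦ a`, `b ↦ ab`. -/

namespace Prohibitions

variable {X : Type*}

/-- The word `v` occurs in `Z` at position `k`. -/
def OccursAt (v : List X) (Z : ℤ → X) (k : ℤ) : Prop :=
  ∀ (i : ℕ) (hi : i < v.length), Z (k + i) = v[i]

theorem isSubword_iff_occursAt {v : List X} {Z : ℤ → X} :
    IsSubword v Z ↔ ∃ k, OccursAt v Z k := Iff.rfl

@[simp] theorem occursAt_nil (Z : ℤ → X) (k : ℤ) : OccursAt [] Z k := fun i hi => by simp at hi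

@[simp] theorem occursAt_cons {x : X} {v : List X} {Z : ℤ → X} {k : ℤ} :
    OccursAt (x :: v) Z k ↔ Z k = x ∧ OccursAt v Z (k + 1) := by
  constructor
  · intro h
    refine ⟨?_, fun i hi => ?_⟩
    · have := h 0 (by simp)
      rw [List.getElem_cons_zero] at this
      simpa using this
    · have := h (i + 1) (by simpa using hi)
      push_cast at this
      rw [add_assoc, add_comm 1 (i : ℤ), this]
      simp
  · rintro ⟨h0, h⟩ i hi
    match i with
    | 0 => simpa using h0
    | i + 1 =>
      have := h i (by simpa using hi)
      rw [add_assoc, add_comm 1 (i : ℤ)] at this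
      push_cast
      rw [this]
      simp

open Classical in
/-- The morphism that maps `b` to `a b` and every other letter to `a`. -/
noncomputable def expand (a b : X) (v : List X) : List X :=
  v.flatMap fun x => if x = b then [a, b] else [a]

section expand

variable {a b : X}

@[simp] theorem expand_nil : expand a b [] = [] := rfl

@[simp] theorem expand_cons_self (v : List X) : expand a b (b :: v) = a :: b :: expand a b v := by
  simp [expand]

theorem expand_cons_of_ne {x : X} (hx : x ≠ b) (v : List X) :
    expand a b (x :: v) = a :: expand a b v := by
  simp [expand, hx]

@[simp] theorem expand_append (u v : List X) :
    expand a b (u ++ v) = expand a b u ++ expand a b v := by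
  simp [expand]

theorem exists_expand_eq_cons {v : List X} (hv : v ≠ []) : ∃ w, expand a b v = a :: w := by
  match v with
  | [] => exact absurd rfl hv
  | x :: v =>
    by_cases hx : x = b
    · subst hx; simp
    · simp [expand_cons_of_ne hx]

theorem exists_expand_append_eq_cons (v : List X) : ∃ w, expand a b v ++ [a] = a :: w := by
  rcases eq_or_ne v [] with rfl | hv
  · simp
  · obtain ⟨w, hw⟩ := exists_expand_eq_cons (a := a) (b := b) hv
    simp [hw]

theorem expand_ne_nil {v : List X} (hv : v ≠ []) : expand a b v ≠ [] := by
  obtain ⟨w, hw⟩ := exists_expand_eq_cons (a := a) (b := b) hv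
  simp [hw]

theorem expand_injective (hab : a ≠ b) (hall : ∀ x, x = a ∨ x = b) : Function.Injective (expand a b) := by
  intro u
  induction u with
  | nil =>
    intro v hv
    by_contra hne
    exact expand_ne_nil (Ne.symm hne) hv.symm
  | cons x u ih =>
    intro v hv
    match v with
    | [] => exact absurd hv (expand_ne_nil (by simp))
    | y :: v =>
      rcases hall x with rfl | rfl <;> rcases hall y with rfl | rfl
      · rw [expand_cons_of_ne hab, expand_cons_of_ne hab] at hv
        rw [ih (List.cons_injective hv)]
      · rw [expand_cons_of_ne hab, expand_cons_self] at hv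
        have h1 := List.cons_injective hv
        rcases eq_or_ne u [] with rfl | hu
        · simp at h1
        · obtain ⟨w, hw⟩ := exists_expand_eq_cons (a := x) (b := y) hu
          rw [hw] at h1
          exact absurd (List.cons.inj h1).1 hab
      · rw [expand_cons_of_ne hab, expand_cons_self] at hv
        have h1 := List.cons_injective hv
        rcases eq_or_ne v [] with rfl | hu
        · simp at h1
        · obtain ⟨w, hw⟩ := exists_expand_eq_cons (a := y) (b := x) hu
          rw [hw] at h1
          exact absurd (List.cons.inj h1).1 hab.symm
      · simp only [expand_cons_self, List.cons.injEq, true_and] at hv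
        rw [ih hv]

end expand

/-- `Z` is obtained from `Z'` by the morphism `expand a b`, the image of the letter `Z' n` starting
at position `e n`. -/
structure IsExpansion (a b : X) (Z' Z : ℤ → X) (e : ℤ → ℤ) : Prop where
  start : ∀ n, Z (e n) = a
  step : ∀ n, (Z' n = b ∧ e (n + 1) = e n + 2 ∧ Z (e n + 1) = b) ∨ (Z' n = a ∧ e (n + 1) = e n + 1)

namespace IsExpansion

variable {a b : X} {Z' Z : ℤ → X} {e : ℤ → ℤ}

theorem cover (h : IsExpansion a b Z' Z e) (k : ℤ) : ∃ n, k = e n ∨ (Z' n = b ∧ k = e n + 1) := by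
  induction k using Int.inductionOn' (b := e 0) with
  | zero => exact ⟨0, Or.inl rfl⟩
  | succ k _ ih =>
    obtain ⟨n, hn⟩ := ih
    have h1 := h.step n
    rcases hn with hn | ⟨h2, hn⟩
    · rcases h1 with ⟨h1, h3, h4⟩ | ⟨h1, h3⟩
      · exact ⟨n, Or.inr ⟨h1, by omega⟩⟩
      · exact ⟨n + 1, Or.inl (by omega)⟩
    · rcases h1 with ⟨h1, h3, h4⟩ | ⟨h1, h3⟩
      · exact ⟨n + 1, Or.inl (by omega)⟩
      · exact ⟨n + 1, by
          have h5 := h.step (n + 1)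
          rcases h5 with ⟨h5, h6, h7⟩ | ⟨h5, h6⟩
          · exact Or.inr ⟨h5, by omega⟩
          · by_cases hab : a = b
            · exact Or.inr ⟨h5.trans hab, by omega⟩
            · exact absurd (h1.symm.trans h2) hab⟩
  | pred k _ ih =>
    obtain ⟨n, hn⟩ := ih
    rcases hn with hn | ⟨h2, hn⟩
    · have h1 := h.step (n - 1)
      rw [sub_add_cancel] at h1
      rcases h1 with ⟨h1, h3, h4⟩ | ⟨h1, h3⟩
      · exact ⟨n - 1, Or.inr ⟨h1, by omega⟩⟩
      · exact ⟨n - 1, Or.inl (by omega)⟩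
    · exact ⟨n, Or.inl (by omega)⟩

theorem shift (h : IsExpansion a b Z' Z e) (c : ℤ) :
    IsExpansion a b (fun n => Z' (n + c)) Z (fun n => e (n + c)) :=
  ⟨fun n => h.start _, fun n => by
    have := h.step (n + c)
    rwa [add_right_comm] at this⟩

theorem sameWord (hab : a ≠ b) {Z₁ Z₂ : ℤ → X} {e₁ e₂ : ℤ → ℤ} (h₁ : IsExpansion a b Z' Z₁ e₁)
    (h₂ : IsExpansion a b Z' Z₂ e₂) : SameWord Z₁ Z₂ := by
  have hstep : ∀ n, e₁ (n + 1) - e₁ n = e₂ (n + 1) - e₂ n := by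
    intro n
    rcases h₁.step n with ⟨h1, h2, -⟩ | ⟨h1, h2⟩ <;> rcases h₂.step n with ⟨h3, h4, -⟩ | ⟨h3, h4⟩
    · omega
    · exact absurd (h3.symm.trans h1) hab
    · exact absurd (h1.symm.trans h3) hab
    · omega
  have hc : ∀ n, e₁ n = e₂ n + (e₁ 0 - e₂ 0) := by
    intro n
    induction n using Int.induction_on with
    | zero => ring
    | succ n ih => have := hstep n; omega
    | pred n ih =>
      have := hstep (-n - 1)
      rw [sub_add_cancel] at this
      omega
  refine ⟨e₁ 0 - e₂ 0, fun i => ?_⟩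
  obtain ⟨n, rfl | ⟨hn, rfl⟩⟩ := h₂.cover i
  · rw [← hc, h₁.start, h₂.start]
  · rw [add_right_comm, ← hc]
    have h3 := h₁.step n
    have h4 := h₂.step n
    rcases h3 with ⟨-, -, h3⟩ | ⟨h3, -⟩
    · rcases h4 with ⟨-, -, h4⟩ | ⟨h4, -⟩
      · rw [h3, h4]
      · exact absurd (h4.symm.trans hn) hab
    · exact absurd (h3.symm.trans hn) hab

/-- The extra `a` is the first letter of the next image. It rules out that a final `a` of the
expanded word is the start of an image `ab`. -/
theorem occursAt_iff (hab : a ≠ b) (hall : ∀ x, x = a ∨ x = b) (h : IsExpansion a b Z' Z e)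
    (v : List X) (n : ℤ) : OccursAt (expand a b v ++ [a]) Z (e n) ↔ OccursAt v Z' n := by
  induction v generalizing n with
  | nil => simp [h.start]
  | cons x v ih =>
    have h1 := h.start n
    have h2 := h.start (n + 1)
    obtain ⟨w, hw⟩ := exists_expand_append_eq_cons (a := a) (b := b) v
    rcases hall x with rfl | rfl
    · rw [expand_cons_of_ne hab, List.cons_append, occursAt_cons, occursAt_cons]
      rcases h.step n with ⟨h3, h4, h5⟩ | ⟨h3, h4⟩
      · simp [hw, h5, hab.symm, h3]
      · rw [← h4, ih]
        simp [h1, h3]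
    · rw [expand_cons_self, List.cons_append, List.cons_append, occursAt_cons, occursAt_cons,
        occursAt_cons]
      rcases h.step n with ⟨h3, h4, h5⟩ | ⟨h3, h4⟩
      · rw [add_assoc, one_add_one_eq_two, ← h4, ih]
        simp [h1, h3, h5]
      · rw [← h4, h2]
        simp [hab, h3]

theorem isSubword_iff (hab : a ≠ b) (hall : ∀ x, x = a ∨ x = b) (h : IsExpansion a b Z' Z e)
    (v : List X) : IsSubword (expand a b v ++ [a]) Z ↔ IsSubword v Z' := by
  simp only [isSubword_iff_occursAt]
  constructor
  · rintro ⟨k, hk⟩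
    obtain ⟨n, rfl | ⟨hn, rfl⟩⟩ := h.cover k
    · exact ⟨n, (h.occursAt_iff hab hall v n).1 hk⟩
    · obtain ⟨w, hw⟩ := exists_expand_append_eq_cons (a := a) (b := b) v
      rw [hw, occursAt_cons] at hk
      rcases h.step n with ⟨h3, h4, h5⟩ | ⟨h3, h4⟩
      · exact absurd (hk.1.symm.trans h5) hab
      · exact absurd (h3.symm.trans hn) hab
  · rintro ⟨n, hn⟩
    exact ⟨e n, (h.occursAt_iff hab hall v n).2 hn⟩

theorem not_isSubword (hab : a ≠ b) (h : IsExpansion a b Z' Z e) : ¬ IsSubword [b, b] Z := by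
  rw [isSubword_iff_occursAt]
  rintro ⟨k, hk⟩
  simp only [occursAt_cons, occursAt_nil, and_true] at hk
  obtain ⟨n, rfl | ⟨hn, rfl⟩⟩ := h.cover k
  · exact hab ((h.start n).symm.trans hk.1)
  · rcases h.step n with ⟨h3, h4, h5⟩ | ⟨h3, h4⟩
    · rw [add_assoc, one_add_one_eq_two, ← h4, h.start] at hk
      exact hab hk.2
    · exact hab (h3.symm.trans hn)

end IsExpansion

/-- Without `bb`, every `b` follows an `a`, so the sequence factors uniquely into blocks `a` and
`ab`. -/
theorem exists_isExpansion {a b : X} (hall : ∀ x, x = a ∨ x = b) {Z : ℤ → X}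
    (hZ : ¬ IsSubword [b, b] Z) : ∃ Z' e, IsExpansion a b Z' Z e := by
  classical
  have hbb : ∀ k, Z k = a ∨ Z (k + 1) = a := by
    intro k
    by_contra! hc
    refine hZ (isSubword_iff_occursAt.2 ⟨k, ?_⟩)
    simp [(hall _).resolve_left hc.1, (hall _).resolve_left hc.2]
  -- The successor map on the positions of `a`. As a permutation it has integer powers, which
  -- enumerate the block starts in both directions.
  let σ : Equiv.Perm {k // Z k = a} :=
    { toFun := fun k => ⟨if Z (k + 1) = a then k + 1 else k + 2, by
        split_ifs with h
        · exact h
        · have := (hbb (k + 1)).resolve_left h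
          rwa [add_assoc, one_add_one_eq_two] at this⟩
      invFun := fun k => ⟨if Z (k - 1) = a then k - 1 else k - 2, by
        split_ifs with h
        · exact h
        · have := hbb (k - 2)
          rw [show (k : ℤ) - 2 + 1 = k - 1 by ring] at this
          exact this.resolve_right h⟩
      left_inv := fun ⟨k, hk⟩ => by
        ext
        by_cases h : Z (k + 1) = a
        · simp [h, hk]
        · have h1 : k + 2 - 1 = k + 1 := by ring
          simp [h, h1]
      right_inv := fun ⟨k, hk⟩ => by
        ext
        by_cases h : Z (k - 1) = a
        · simp [h, hk]
        · have h1 : k - 2 + 1 = k - 1 := by ring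
          simp [h, h1] }
  obtain ⟨k₀, hk₀⟩ : ∃ k, Z k = a := (hbb 0).elim (fun h => ⟨_, h⟩) fun h => ⟨_, h⟩
  let e : ℤ → {k // Z k = a} := fun n => (σ ^ n) ⟨k₀, hk₀⟩
  have he : ∀ n, e (n + 1) = σ (e n) := fun n => by
    simp only [e]
    rw [add_comm, zpow_one_add, Equiv.Perm.mul_apply]
  -- The letter after a block start already identifies the block: `b` for `ab`, `a` for `a`.
  refine ⟨fun n => Z (e n + 1), fun n => e n, fun n => (e n).2, fun n => ?_⟩
  rw [he]
  by_cases h : Z ((e n : ℤ) + 1) = a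
  · right
    exact ⟨h, by simp [σ, h]⟩
  · left
    have h' := (hall _).resolve_left h
    exact ⟨h', by simp [σ, h], h'⟩

/-- If `V` determines `W'`, then one more prohibition suffices for the expansion of `W'`. -/
theorem IsExpansion.exists_determines {a b : X} (hab : a ≠ b) (hall : ∀ x, x = a ∨ x = b)
    {W' W : ℤ → X} {e : ℤ → ℤ} (h : IsExpansion a b W' W e) {V : Finset (List X)}
    (hV : Determines V W') : ∃ V', V'.card = V.card + 1 ∧ Determines V' W := by
  classical
  refine ⟨insert [b, b] (V.image fun v => expand a b v ++ [a]), ?_, ?_, ?_⟩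
  · rw [Finset.card_insert_of_notMem, Finset.card_image_of_injective]
    · intro u v huv
      exact expand_injective hab hall (List.append_cancel_right huv)
    · simp only [Finset.mem_image, not_exists, not_and]
      intro v _ hv
      have := congrArg List.getLast? hv
      simp at this
      exact hab this
  · intro v hv
    simp only [Finset.mem_insert, Finset.mem_image] at hv
    rcases hv with rfl | ⟨v, hv, rfl⟩
    · exact h.not_isSubword hab
    · rw [h.isSubword_iff hab hall]
      exact hV.1 v hv
  · intro Z hZ
    obtain ⟨Z', e', h'⟩ := exists_isExpansion hall (hZ _ (Finset.mem_insert_self _ _))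
    obtain ⟨c, hc⟩ := hV.2 Z' fun v hv hs =>
      hZ _ (Finset.mem_insert_of_mem (Finset.mem_image_of_mem _ hv))
        ((h'.isSubword_iff hab hall v).2 hs)
    obtain rfl : Z' = fun n => W' (n + c) := funext hc
    exact (h.shift c).sameWord hab h'

end Prohibitions

/-! ### Expanding periodic words; the Fibonacci words. -/

namespace Prohibitions

variable {X : Type*}

/-- The position where the image of the `n`-th letter starts in the expansion of `u^∞`. -/
noncomputable def expandPos (a b : X) (u : List X) (n : ℤ) : ℤ :=
  (expand a b u).length * (n / u.length) + (expand a b (u.take (n % u.length).toNat)).length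

theorem expandPos_add_one (a b : X) {u : List X} (q : ℤ) {r : ℕ} (hr : r < u.length) :
    expandPos a b u (u.length * q + r + 1) =
      (expand a b u).length * q + (expand a b (u.take (r + 1))).length := by
  have hpos : (0 : ℤ) < u.length := by omega
  rw [expandPos, add_assoc, Int.mul_add_ediv_left _ _ hpos.ne', Int.mul_add_emod_self_left]
  rcases Nat.lt_or_ge (r + 1) u.length with h | h
  · rw [Int.ediv_eq_zero_of_lt (by omega) (by omega), Int.emod_eq_of_lt (by omega) (by omega)]
    simp [show ((r : ℤ) + 1).toNat = r + 1 by omega]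
  · have h1 : (r : ℤ) + 1 = u.length := by omega
    have h2 : r + 1 = u.length := by omega
    rw [h1, Int.ediv_self hpos.ne', Int.emod_self, h2]
    simp
    ring

theorem expandPos_eq (a b : X) {u : List X} (q : ℤ) {r : ℕ} (hr : r < u.length) :
    expandPos a b u (u.length * q + r) =
      (expand a b u).length * q + (expand a b (u.take r)).length := by
  have hpos : (0 : ℤ) < u.length := by omega
  rw [expandPos, Int.mul_add_ediv_left _ _ hpos.ne', Int.mul_add_emod_self_left,
    Int.ediv_eq_zero_of_lt (by omega) (by omega), Int.emod_eq_of_lt (by omega) (by omega)]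
  simp

theorem periodicWord_mul_add (u : List X) (hu : u ≠ []) (q : ℤ) {r : ℕ} {x : X}
    (h : u[r]? = some x) : periodicWord u hu (u.length * q + r) = x := by
  obtain ⟨hr, rfl⟩ := List.getElem?_eq_some_iff.1 h
  rw [add_comm, apply_add_mul (periodicWord_periodic u hu), periodicWord_of_lt u hu hr]

theorem isExpansion_periodicWord {a b : X} (hall : ∀ x, x = a ∨ x = b) {u : List X}
    (hu : u ≠ []) : IsExpansion a b (periodicWord u hu)
      (periodicWord (expand a b u) (expand_ne_nil hu)) (expandPos a b u) := by
  have hpos : (0 : ℤ) < u.length := by have := List.length_pos_iff.2 hu; omega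
  have key : ∀ n : ℤ, ∃ (q : ℤ) (r : ℕ), r < u.length ∧ n = u.length * q + r := fun n => by
    have h0 := Int.emod_nonneg n hpos.ne'
    have h1 := Int.emod_lt_of_pos n hpos
    refine ⟨n / u.length, (n % u.length).toNat, by omega, ?_⟩
    rw [Int.toNat_of_nonneg h0, Int.mul_ediv_add_emod]
  have hsplit : ∀ r (hr : r < u.length), expand a b u =
      expand a b (u.take r) ++ (expand a b [u[r]] ++ expand a b (u.drop (r + 1))) := by
    intro r hr
    rw [← expand_append, ← expand_append, List.singleton_append, ← List.drop_eq_getElem_cons hr,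
      List.take_append_drop]
  refine ⟨fun n => ?_, fun n => ?_⟩
  · obtain ⟨q, r, hr, rfl⟩ := key n
    rw [expandPos_eq a b q hr]
    apply periodicWord_mul_add
    obtain ⟨w, hw⟩ := exists_expand_eq_cons (a := a) (b := b) (v := [u[r]]) (by simp)
    rw [hsplit r hr, List.getElem?_append_right le_rfl, hw]
    simp
  · obtain ⟨q, r, hr, rfl⟩ := key n
    rw [expandPos_eq a b q hr, expandPos_add_one a b q hr,
      periodicWord_mul_add u hu q (List.getElem?_eq_getElem hr), List.take_succ_eq_append_getElem hr,
      expand_append]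
    by_cases hx : u[r] = b
    · left
      refine ⟨hx, by simp [hx]; ring, ?_⟩
      rw [add_assoc, ← Nat.cast_succ]
      apply periodicWord_mul_add
      rw [hsplit r hr, List.getElem?_append_right (by omega), hx]
      simp
    · right
      refine ⟨(hall _).resolve_right hx, ?_⟩
      rw [expand_cons_of_ne hx]
      simp
      ring

/-- The bi-infinite word `u^∞` is determined by a system of `n` prohibitions. -/
def DeterminedBy (n : ℕ) (u : List X) : Prop :=
  ∃ hu : u ≠ [], ∃ V : Finset (List X), V.card = n ∧ Determines V (periodicWord u hu)

theorem DeterminedBy.expand {a b : X} (hab : a ≠ b) (hall : ∀ x, x = a ∨ x = b) {n : ℕ}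
    {u : List X} (h : DeterminedBy n u) : DeterminedBy (n + 1) (expand a b u) := by
  obtain ⟨hu, V, rfl, hV⟩ := h
  exact ⟨expand_ne_nil hu, (isExpansion_periodicWord hall hu).exists_determines hab hall hV⟩

theorem sameWord_rotate (x : X) (v : List X) : SameWord (periodicWord (x :: v) (by simp))
    (periodicWord (v ++ [x]) (by simp)) := by
  refine ⟨1, fun i => ?_⟩
  set l : ℤ := (v.length : ℤ) + 1 with hl
  have h1 := Int.emod_nonneg i (b := l) (by omega)
  have h2 := Int.emod_lt_of_pos i (b := l) (by omega)
  have hi : i = l * (i / l) + (i % l).toNat := by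
    rw [Int.toNat_of_nonneg h1, Int.mul_ediv_add_emod]
  set q := i / l
  set r := (i % l).toNat
  have hr : r ≤ v.length := by omega
  have e1 := fun y => periodicWord_mul_add (v ++ [x]) (by simp) q (r := r) (x := y)
  simp only [List.length_append, List.length_singleton, Nat.cast_add, Nat.cast_one, ← hl,
    ← hi] at e1
  rcases hr.lt_or_eq with hr | hr
  · have e2 := periodicWord_mul_add (x :: v) (by simp) q (r := r + 1) (x := v[r]) (by simp [hr])
    simp only [List.length_cons, Nat.cast_add, Nat.cast_one, ← hl, ← add_assoc, ← hi] at e2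
    rw [e2]
    exact e1 _ (by rw [List.getElem?_append_left hr, List.getElem?_eq_getElem hr])
  · have e2 := periodicWord_mul_add (x :: v) (by simp) (q + 1) (r := 0) (x := x) (by simp)
    simp only [List.length_cons, Nat.cast_add, Nat.cast_one, ← hl] at e2
    rw [show l * (q + 1) + (0 : ℕ) = i + 1 by rw [hi, hr, hl]; push_cast; ring] at e2
    rw [e2]
    exact e1 _ (by simp [hr])

theorem DeterminedBy.rotate {n : ℕ} {x : X} {v : List X} (h : DeterminedBy n (x :: v)) :
    DeterminedBy n (v ++ [x]) := by
  obtain ⟨hu, V, hn, hV⟩ := h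
  exact ⟨by simp, V, hn, hV.of_sameWord (sameWord_rotate x v)⟩

open Classical in
/-- The morphism that maps `a` to `a b` and every other letter to `b`. -/
noncomputable def expandRight (a b : X) (v : List X) : List X :=
  v.flatMap fun x => if x = a then [a, b] else [b]

@[simp] theorem expandRight_append (a b : X) (u v : List X) :
    expandRight a b (u ++ v) = expandRight a b u ++ expandRight a b v := by
  simp [expandRight]

/-- The images under `a ↦ ab` and `a ↦ ba` (with `b ↦ b`) are conjugate by `b`, so they are cyclic
rotations of each other and define the same bi-infinite word. -/
theorem cons_expandRight (a b : X) (u : List X) :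
    b :: expandRight a b u = expand b a u ++ [b] := by
  induction u with
  | nil => rfl
  | cons x u ih =>
    by_cases hx : x = a
    · subst hx
      rw [expand_cons_self, List.cons_append, List.cons_append, ← ih]
      simp [expandRight]
    · rw [expand_cons_of_ne hx, List.cons_append, ← ih]
      simp [expandRight, hx]

theorem DeterminedBy.expandRight {a b : X} (hab : a ≠ b) (hall : ∀ x, x = a ∨ x = b) {n : ℕ}
    {u : List X} (h : DeterminedBy n u) : DeterminedBy (n + 1) (expandRight a b u) := by
  have h1 := h.expand hab.symm fun x => (hall x).symm
  obtain ⟨w, hw⟩ := exists_expand_eq_cons (a := b) (b := a) h.1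
  have h2 := cons_expandRight a b u
  rw [hw, List.cons_append, List.cons.injEq] at h2
  rw [h2.2]
  rw [hw] at h1
  exact h1.rotate

theorem fibS_succ (a b : X) (i : ℕ) :
    fibS a b (i + 1) = fibS a b i ++ fibS a b i ++ fibT a b i := rfl

theorem fibT_succ (a b : X) (i : ℕ) : fibT a b (i + 1) = fibS a b i ++ fibT a b i := rfl

theorem fib_succ_eq_expand {a b : X} (hab : a ≠ b) (i : ℕ) :
    fibS a b (i + 1) = expand a b (expandRight a b (fibS a b i)) ∧
      fibT a b (i + 1) = expand a b (expandRight a b (fibT a b i)) := by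
  induction i with
  | zero =>
    simp [fibS, fibT, fibPair, expandRight, expand_cons_of_ne hab, hab.symm]
  | succ i ih =>
    obtain ⟨h1, h2⟩ := ih
    constructor
    · rw [fibS_succ a b (i + 1)]
      nth_rw 3 [fibS_succ]
      simp [h1, h2]
    · rw [fibT_succ a b (i + 1)]
      nth_rw 2 [fibT_succ]
      simp [h1, h2]

theorem determinedBy_singleton {x y : X} (hxy : x ≠ y) (hall : ∀ z, z = x ∨ z = y) :
    DeterminedBy 1 [x] := by
  have hP : ∀ i, periodicWord [x] (by simp) i = x := fun i => by simp [periodicWord]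
  refine ⟨by simp, {[y]}, by simp, ?_, fun Z hZ => ⟨0, fun i => ?_⟩⟩
  · intro v hv
    rw [Finset.mem_singleton.1 hv, isSubword_iff_occursAt]
    rintro ⟨k, hk⟩
    rw [occursAt_cons, hP] at hk
    exact hxy hk.1
  · rw [hP]
    refine (hall _).resolve_right fun hi => hZ [y] (by simp) ?_
    exact isSubword_iff_occursAt.2 ⟨i, by simp [hi]⟩

theorem determinedBy_fibS {a b : X} (hab : a ≠ b) (hall : ∀ x, x = a ∨ x = b) (i : ℕ) :
    DeterminedBy (2 * i + 1) (fibS a b i) := by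
  induction i with
  | zero => exact determinedBy_singleton hab hall
  | succ i ih =>
    rw [(fib_succ_eq_expand hab i).1]
    exact (ih.expandRight hab hall).expand hab hall

theorem determinedBy_fibT {a b : X} (hab : a ≠ b) (hall : ∀ x, x = a ∨ x = b) (i : ℕ) :
    DeterminedBy (2 * (i + 1)) (fibT a b (i + 1)) := by
  induction i with
  | zero =>
    -- The induction starts at `t_1 = ab`, the expansion of `b`, whose periodic word is determined
    -- by forbidding `a`.
    have := (determinedBy_singleton hab.symm fun x => (hall x).symm).expand hab hall
    rwa [expand_cons_self] at this
  | succ i ih =>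
    rw [(fib_succ_eq_expand hab (i + 1)).2]
    exact (ih.expandRight hab hall).expand hab hall

theorem length_fib (a b : X) (i : ℕ) :
    (fibT a b i).length = F (2 * i) ∧ (fibS a b i).length = F (2 * i + 1) := by
  induction i with
  | zero => exact ⟨rfl, rfl⟩
  | succ i ih =>
    have h1 := F_add_two (2 * i)
    have h2 := F_add_two (2 * i + 1)
    rw [fibT_succ, fibS_succ, mul_add, mul_one]
    simp only [List.length_append, ih]
    rw [show 2 * i + 1 + 2 = 2 * i + 2 + 1 from rfl] at h2
    rw [show 2 * i + 1 + 1 = 2 * i + 2 from rfl] at h2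
    constructor <;> omega

theorem count_wordPow [DecidableEq X] (x : X) (v : List X) (n : ℕ) :
    (wordPow v n).count x = n * v.count x := by
  induction n with
  | zero => simp [wordPow]
  | succ n ih => rw [wordPow_succ, List.count_append, ih]; ring

/-- The recursion acts on letter counts by a matrix of determinant 1. Hence the two counts in each
word are coprime, which excludes proper powers. -/
theorem count_fib [DecidableEq X] {a b : X} (hab : a ≠ b) (i : ℕ) :
    ((fibS a b i).count a : ℤ) * (fibT a b i).count b
      - (fibS a b i).count b * (fibT a b i).count a = 1 := by
  induction i with
  | zero => simp [fibS, fibT, fibPair, hab, hab.symm]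
  | succ i ih =>
    rw [fibT_succ, fibS_succ]
    simp only [List.count_append]
    push_cast
    linear_combination ih

theorem nonperiodic_of_count [DecidableEq X] {u : List X} {x y : X} {c d : ℤ}
    (h : c * u.count x + d * u.count y = 1) : Nonperiodic u := by
  refine ⟨by rintro rfl; simp at h, ?_⟩
  rintro ⟨v, n, hn, rfl⟩
  rw [count_wordPow, count_wordPow] at h
  have hd : (n : ℤ) ∣ 1 := ⟨c * v.count x + d * v.count y, by rw [← h]; push_cast; ring⟩
  have := Int.le_of_dvd one_pos hd
  omega

theorem nonperiodic_fibS {a b : X} (hab : a ≠ b) (i : ℕ) : Nonperiodic (fibS a b i) := by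
  classical
  exact nonperiodic_of_count (x := a) (y := b) (c := (fibT a b i).count b)
    (d := -(fibT a b i).count a) (by linear_combination count_fib hab i)

theorem nonperiodic_fibT {a b : X} (hab : a ≠ b) (i : ℕ) : Nonperiodic (fibT a b i) := by
  classical
  exact nonperiodic_of_count (x := b) (y := a) (c := (fibS a b i).count a)
    (d := -(fibS a b i).count b) (by linear_combination count_fib hab i)

theorem eq_or_eq_of_card_eq_two [Fintype X] (hX : Fintype.card X = 2) {a b : X} (hab : a ≠ b)
    (x : X) : x = a ∨ x = b := by
  classical
  have hs : ({a, b} : Finset X) = Finset.univ :=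
    Finset.eq_univ_of_card _ (by rw [Finset.card_pair hab, hX])
  have := Finset.mem_univ x
  rw [← hs] at this
  simpa using this

end Prohibitions

theorem mainTheorem1 {X : Type*} [Fintype X] (hX : Fintype.card X = 2) :
    -- the upper bound
    (∀ (V : Finset (List X)) (u : List X) (hu : Prohibitions.Nonperiodic u),
      Prohibitions.Determines V (Prohibitions.periodicWord u hu.1) →
        u.length ≤ Prohibitions.F V.card) ∧
    -- sharpness for every number `2 * i` or `2 * i + 1` of prohibitions, `i ≥ 1`
    (∀ a b : X, a ≠ b → ∀ i : ℕ, 1 ≤ i →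
      (∃ hu : Prohibitions.Nonperiodic (Prohibitions.fibT a b i),
        (Prohibitions.fibT a b i).length = Prohibitions.F (2 * i) ∧
        ∃ V : Finset (List X), V.card = 2 * i ∧
          Prohibitions.Determines V (Prohibitions.periodicWord (Prohibitions.fibT a b i) hu.1)) ∧
      (∃ hu : Prohibitions.Nonperiodic (Prohibitions.fibS a b i),
        (Prohibitions.fibS a b i).length = Prohibitions.F (2 * i + 1) ∧
        ∃ V : Finset (List X), V.card = 2 * i + 1 ∧
          Prohibitions.Determines V (Prohibitions.periodicWord (Prohibitions.fibS a b i) hu.1))) := by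
  refine ⟨fun V u hu hV => ?_, fun a b hab i hi => ?_⟩
  · refine Prohibitions.length_le_F (fun x y z hxy hzy => ?_) hu hV
    exact ((Prohibitions.eq_or_eq_of_card_eq_two hX hxy z).resolve_right hzy).symm
  · have hall := Prohibitions.eq_or_eq_of_card_eq_two hX hab
    obtain ⟨i, rfl⟩ : ∃ j, i = j + 1 := ⟨i - 1, by omega⟩
    refine ⟨⟨Prohibitions.nonperiodic_fibT hab _, (Prohibitions.length_fib a b _).1, ?_⟩,
      ⟨Prohibitions.nonperiodic_fibS hab _, (Prohibitions.length_fib a b _).2, ?_⟩⟩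
    · obtain ⟨_, V, hV⟩ := Prohibitions.determinedBy_fibT hab hall i
      exact ⟨V, hV⟩
    · obtain ⟨_, V, hV⟩ := Prohibitions.determinedBy_fibS hab hall (i + 1)
      exact ⟨V, hV⟩
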